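/- Let $w:[0,1]\to[0,\infty)$ be continuous and strictly positive on $(0,\delta)$ for some $\delta\in(0,1]$. Let $\{X_t:t\in\mathbb Z\}$ be a strictly stationary $\mathbb R^d$-valued process with finite second moments and mean $\mu_0=\mathrm E X_t$, and suppose that the matrix $\Sigma=\sum_{j=-\infty}^{\infty}\mathrm{Cov}(X_0,X_j)$ exists and is positive definite. Let $B=(B_1,\dots,B_d)'$ be a vector of independent standard Brownian motions on $[0,1]$ with continuous paths, let $S_n$ be the linear interpolation on $[0,1]$ of $S_n(i/n)=\sum_{j=1}^i(X_j-\mu_0)$, $i=0,\dots,n$, and suppose that $n^{-1/2}S_n\to\Sigma^{1/2}B$ in distribution in the space $C_d[0,1]$ of continuous functions $[0,1]\to\mathbb R^d$ with the supremum metric. For $\mu\in\mathbb R^d$ put $T_{i,\mu}=w(i/n)\sum_{j=1}^i(X_j-\mu)$, $i=1,\dots,n$, $$L_n(\mu)=\sup\Big\{\prod_{i=1}^n p_i:\ p_i\ge 0,\ \sum_{i=1}^n p_i=1,\ \sum_{i=1}^n p_iT_{i,\mu}=0\Big\}$$ (with $\sup\emptyset=0$), $R_n(\mu)=n^{n}L_n(\mu)$,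 and $G_n=\{\mu\in\mathbb R^d: R_n(\mu)\ge R_n(\mu_0)>0\}$; read $-\log 0=+\infty$. (i) For every $c\in\mathbb R^d$, let $f_c(t)=w(t)[B(t)+t\Sigma^{-1/2}c]$, $t\in[0,1]$. Then, with probability one, $$m_c=\min\Big\{-\int_0^1\log(1+a'f_c(t))\,dt:\ a\in\mathbb R^d,\ \min_{0\le t\le1}(1+a'f_c(t))\ge0\Big\}$$ exists, that is, it is attained and finite, and, as $n\to\infty$, both $-n^{-1}\log R_n(\mu_0+n^{-1/2}c)$ and $-n^{-1}\log R_n(\mu_0-n^{-1/2}c)$ converge in distribution to $-m_c$. (ii) $\sup\{\|\mu-\mu_0\|:\mu\in G_n\}=O_p(n^{-1/2})$ (with $\sup\emptyset=0$): for every $\varepsilon>0$ there is a constant $M$ such that $P\big(\sup\{\|\mu-\mu_0\|:\mu\in G_n\}>Mn^{-1/2}\big)\le\varepsilon$ for all sufficiently large $n$. -/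

import Mathlib

open MeasureTheory ProbabilityTheory Filter Topology
open scoped ENNReal NNReal unitInterval

namespace EBEL

/-- `ℝ^d` with the Euclidean norm and inner product. -/
abbrev E (d : ℕ) : Type := EuclideanSpace ℝ (Fin d)

/-- The space `C_d[0,1]` of continuous `ℝ^d`-valued functions on `[0,1]`
(its topology is that of uniform convergence). -/
abbrev Paths (d : ℕ) : Type := C(I, E d)

/-- The Borel σ-algebra on `C_d[0,1]`. -/
noncomputable instance instMeasurableSpacePaths (d : ℕ) : MeasurableSpace (Paths d) :=
  borel (Paths d)

instance instBorelSpacePaths (d : ℕ) : BorelSpace (Paths d) := ⟨rfl⟩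

/-! ### Assumptions -/

/-- The weight function `w : [0,1] → [0,∞)` is continuous, and strictly positive on some interval
`(0, δ)` with `δ ∈ (0,1]`. Only the values of `w` on `[0,1]` are ever used. -/
structure IsWeight (w : ℝ → ℝ) : Prop where
  continuousOn : ContinuousOn w (Set.Icc 0 1)
  nonneg : ∀ t ∈ Set.Icc (0 : ℝ) 1, 0 ≤ w t
  pos : ∃ δ ∈ Set.Ioc (0 : ℝ) 1, ∀ t ∈ Set.Ioo 0 δ, 0 < w t

/-- `(X_t)`, `t ∈ ℤ`, is strictly stationary: the law of the whole process is invariant under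
time shifts. -/
structure IsStrictlyStationary {Ω : Type*} [MeasurableSpace Ω] {d : ℕ}
    (X : ℤ → Ω → E d) (P : Measure Ω) : Prop where
  measurable : ∀ t, Measurable (X t)
  shift : ∀ k : ℤ, P.map (fun ω (t : ℤ) => X (t + k) ω) = P.map (fun ω (t : ℤ) => X t ω)

/-- `S = ∑_{j=-∞}^{∞} Cov(X_0, X_j)`, entrywise, as the limit of the partial sums over
`-N ≤ j ≤ N`. -/
def IsLongRunCovariance {Ω : Type*} [MeasurableSpace Ω] {d : ℕ}
    (X : ℤ → Ω → E d) (P : Measure Ω) (S : Matrix (Fin d) (Fin d) ℝ) : Prop :=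
  ∀ k l : Fin d,
    Tendsto (fun N : ℕ => ∑ j ∈ Finset.Icc (-(N : ℤ)) (N : ℤ),
      cov[fun ω => X 0 ω k, fun ω => X j ω l; P]) atTop (𝓝 (S k l))

/-- `B = (B_1, …, B_d)` is a random element of `C_d[0,1]` whose coordinates are independent
standard Brownian motions on `[0,1]`. -/
structure IsBrownian {Ω : Type*} [MeasurableSpace Ω] {d : ℕ}
    (B : Ω → Paths d) (P : Measure Ω) : Prop where
  measurable : Measurable B
  zero : ∀ᵐ ω ∂P, B ω 0 = 0
  indepIncrements : ∀ i : Fin d, HasIndepIncrements (fun (t : I) ω => B ω t i) P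
  gaussianIncrements : ∀ i : Fin d, ∀ s t : I, s ≤ t →
    P.map (fun ω => B ω t i - B ω s i) = gaussianReal 0 (Real.toNNReal ((t : ℝ) - s))
  indepCoordinates : iIndepFun (fun (i : Fin d) ω (t : I) => B ω t i) P

/-! ### The partial sum process -/

/-- The path on `[0,1]` obtained by linear interpolation of
`S_n(i/n) = ∑_{j=1}^i (x_j - μ)`, `i = 0, …, n`: the `j`-th summand enters with a weight that
grows linearly from `0` at time `(j-1)/n` to `1` at time `j/n`. -/
noncomputable def partialSumPath {d : ℕ} (x : ℤ → E d) (μ : E d) (n : ℕ) : Paths d where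
  toFun t := ∑ j ∈ Finset.Icc 1 n,
    (max 0 (min 1 ((n : ℝ) * (t : ℝ) - ((j : ℝ) - 1)))) • (x j - μ)
  continuous_toFun := by fun_prop

open scoped MatrixOrder in
/-- The positive semidefinite square root `S^{1/2}` of a positive semidefinite matrix. -/
noncomputable def matrixSqrt {d : ℕ} (S : Matrix (Fin d) (Fin d) ℝ) : Matrix (Fin d) (Fin d) ℝ :=
  CFC.sqrt S

/-- The path `t ↦ A b(t)`. -/
noncomputable def matrixPath {d : ℕ} (A : Matrix (Fin d) (Fin d) ℝ) (b : Paths d) : Paths d where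
  toFun t := Matrix.toEuclideanCLM (𝕜 := ℝ) A (b t)
  continuous_toFun := by fun_prop

/-! ### Expansive block empirical likelihood -/

/-- The weighted centered block sum `T_{i,μ} = w(i/n) ∑_{j=1}^i (x_j - μ)`. -/
noncomputable def blockSum {d : ℕ} (w : ℝ → ℝ) (x : ℤ → E d) (n : ℕ) (μ : E d) (i : ℕ) : E d :=
  w ((i : ℝ) / (n : ℝ)) • ∑ j ∈ Finset.Icc 1 i, (x j - μ)

/-- `L_n(μ) = sup {∏ p_i : p_i ≥ 0, ∑ p_i = 1, ∑ p_i T_{i,μ} = 0}`. The set is bounded (by `1`),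
and the supremum is `0` when there is no feasible `p`. -/
noncomputable def likelihood {d : ℕ} (w : ℝ → ℝ) (x : ℤ → E d) (n : ℕ) (μ : E d) : ℝ :=
  sSup {L : ℝ | ∃ p : ℕ → ℝ, (∀ i ∈ Finset.Icc 1 n, 0 ≤ p i) ∧
    ∑ i ∈ Finset.Icc 1 n, p i = 1 ∧
    ∑ i ∈ Finset.Icc 1 n, p i • blockSum w x n μ i = 0 ∧
    L = ∏ i ∈ Finset.Icc 1 n, p i}

/-- The likelihood ratio `R_n(μ) = L_n(μ) / n^{-n}`. -/
noncomputable def ratio {d : ℕ} (w : ℝ → ℝ) (x : ℤ → E d) (n : ℕ) (μ : E d) : ℝ :=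
  (n : ℝ) ^ n * likelihood w x n μ

/-- `-n⁻¹ log R_n(μ)`, with value `+∞` when `R_n(μ) = 0`. -/
noncomputable def negLogRatio {d : ℕ} (w : ℝ → ℝ) (x : ℤ → E d) (n : ℕ) (μ : E d) : EReal :=
  -((((n : ℝ)⁻¹ : ℝ) : EReal) * ENNReal.log (ENNReal.ofReal (ratio w x n μ)))

/-- `G_n = {μ : R_n(μ) ≥ R_n(μ₀) > 0}`. -/
def likelyMeans {d : ℕ} (w : ℝ → ℝ) (x : ℤ → E d) (n : ℕ) (μ₀ : E d) : Set (E d) :=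
  {μ | ratio w x n μ₀ ≤ ratio w x n μ ∧ 0 < ratio w x n μ₀}

/-- `sup {‖μ - μ₀‖ : μ ∈ G_n}` in `[0,∞]` (`0` if `G_n` is empty). -/
noncomputable def likelyRadius {d : ℕ} (w : ℝ → ℝ) (x : ℤ → E d) (n : ℕ) (μ₀ : E d) : ℝ≥0∞ :=
  ⨆ μ ∈ likelyMeans w x n μ₀, ‖μ - μ₀‖ₑ

/-! ### The limit -/

/-- `f_c(t) = w(t) [b(t) + t S^{-1/2} c]`. -/
noncomputable def drifted {d : ℕ} (w : ℝ → ℝ) (S : Matrix (Fin d) (Fin d) ℝ) (c : E d)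
    (b : Paths d) (t : I) : E d :=
  w t • (b t + (t : ℝ) • Matrix.toEuclideanCLM (𝕜 := ℝ) (matrixSqrt S)⁻¹ c)

/-- The closed constraint set `{a : min_t (1 + a' f(t)) ≥ 0}`. -/
def constraintSet {d : ℕ} (f : I → E d) : Set (E d) :=
  {a | ∀ t : I, 0 ≤ 1 + inner ℝ a (f t)}

/-- `-∫_0^1 log (1 + a' f(t)) dt ∈ [-∞, ∞]`, the integral of the negative part of the logarithm
minus that of the positive part, with `log 0 = -∞`. For continuous `f` the second integral is
finite. -/
noncomputable def objective {d : ℕ} (f : I → E d) (a : E d) : EReal :=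
  ((∫⁻ t : I, (-ENNReal.log (ENNReal.ofReal (1 + inner ℝ a (f t)))).toENNReal : ℝ≥0∞) : EReal) -
    ((∫⁻ t : I, (ENNReal.log (ENNReal.ofReal (1 + inner ℝ a (f t)))).toENNReal : ℝ≥0∞) : EReal)

/-- `min {-∫_0^1 log (1 + a' f(t)) dt : a in the constraint set}`, as an infimum. -/
noncomputable def minObjective {d : ℕ} (f : I → E d) : EReal :=
  sInf (objective f '' constraintSet f)

/-! ### Stochastic order -/

/-- `D_n = O_p(r_n)`: for every `ε > 0` there is a constant `M` with `P(D_n > M r_n) ≤ ε` for all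
sufficiently large `n`. -/
def IsBigOInProbability {Ω : Type*} [MeasurableSpace Ω] (P : Measure Ω)
    (D : ℕ → Ω → ℝ≥0∞) (r : ℕ → ℝ) : Prop :=
  ∀ ε : ℝ, 0 < ε → ∃ M : ℝ, ∀ᶠ n in atTop,
    P {ω | ENNReal.ofReal (M * r n) < D n ω} ≤ ENNReal.ofReal ε

end EBEL

open MeasureTheory ProbabilityTheory Filter Topology
open scoped ENNReal NNReal unitInterval

namespace EBEL

/-! ### Duality for a finite family of vectors -/

/-! The likelihood is unchanged when all block sums are multiplied by `n ^ (-1/2)`, and centering at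
`μ₀ + n ^ (-1/2) c` instead of `μ₀` adds the drift `-t c`. So `-n⁻¹ log R_n` is a functional
`seqNegLog` of the grid values of the path `w(t) (Y_n(t) - t c)`, where `Y_n` is the rescaled
partial sum path (`negLogRatio_eq_gridValues`).

Convex duality (`exists_dual_max`) turns this functional into the maximum over `a` of the grid
average of `log (1 + a' f)`. If paths `f_n` converge uniformly to a path `g` contained in no closed
half-space (`Spans`), the dual feasible sets are eventually uniformly bounded and the maxima
converge to `-minObjective g` (`tendsto_seqNegLog`). The logarithm is unbounded near the boundary of
the feasible set; truncating it from below bounds the maxima from above, and shrinking a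
near-optimal `a` towards `0` bounds them from below.

The limit path spans almost surely: by Borel-Cantelli along rapidly decreasing times, Brownian
motion visits every open orthant arbitrarily close to time `0`, at distance of order `√t` from the
walls, so a linear drift is negligible (`IsBrownian.exists_inner_neg`). The extended continuous
mapping theorem (`tendstoInDistribution_of_continuousConvergence`) then gives the limit law. The
matrix `S^{1/2}` is absorbed into `a`, and the sign of `c` is immaterial because Brownian motion is
symmetric (`IsBrownian.map_minObjective_neg`).

For the radius, choosing `a` of bounded length opposite to `c` in weak duality makes `-n⁻¹ log
R_n(μ₀ + n ^ (-1/2) c)` large once `‖c‖` is large, as long as the path is bounded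
(`norm_le_of_seqNegLog_le`). The path norms and `-n⁻¹ log R_n(μ₀)` are both tight, so the likely
region has radius `O_p(n ^ (-1/2))`. -/

/-- `sup {∏ p_i : p_i ≥ 0, ∑ p_i = 1, ∑ p_i T_i = 0}` for a sequence of vectors `T`. -/
noncomputable def seqLikelihood {d : ℕ} (n : ℕ) (T : ℕ → E d) : ℝ :=
  sSup {L : ℝ | ∃ p : ℕ → ℝ, (∀ i ∈ Finset.Icc 1 n, 0 ≤ p i) ∧
    ∑ i ∈ Finset.Icc 1 n, p i = 1 ∧
    ∑ i ∈ Finset.Icc 1 n, p i • T i = 0 ∧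
    L = ∏ i ∈ Finset.Icc 1 n, p i}

/-- `-n⁻¹ log (nⁿ L)`, where `L` is the likelihood of the vectors `T_1, …, T_n`. -/
noncomputable def seqNegLog {d : ℕ} (n : ℕ) (T : ℕ → E d) : EReal :=
  -((((n : ℝ)⁻¹ : ℝ) : EReal) * ENNReal.log (ENNReal.ofReal ((n : ℝ) ^ n * seqLikelihood n T)))

lemma negLogRatio_eq_seqNegLog {d : ℕ} (w : ℝ → ℝ) (x : ℤ → E d) (n : ℕ) (μ : E d) :
    negLogRatio w x n μ = seqNegLog n (blockSum w x n μ) := rfl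

lemma seqLikelihood_congr {d n : ℕ} {T T' : ℕ → E d}
    (h : ∀ i ∈ Finset.Icc 1 n, T i = T' i) : seqLikelihood n T = seqLikelihood n T' := by
  unfold seqLikelihood
  congr 1
  ext L
  refine exists_congr fun p => ?_
  have : ∑ i ∈ Finset.Icc 1 n, p i • T i = ∑ i ∈ Finset.Icc 1 n, p i • T' i :=
    Finset.sum_congr rfl fun i hi => by rw [h i hi]
  rw [this]

/-- The moment constraint is homogeneous in `T`; this absorbs the normalization `n ^ (-1/2)`. -/
lemma seqLikelihood_smul {d n : ℕ} {T : ℕ → E d} {r : ℝ} (hr : r ≠ 0) :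
    seqLikelihood n (fun i => r • T i) = seqLikelihood n T := by
  unfold seqLikelihood
  congr 1
  ext L
  refine exists_congr fun p => ?_
  have : ∑ i ∈ Finset.Icc 1 n, p i • r • T i = r • ∑ i ∈ Finset.Icc 1 n, p i • T i := by
    rw [Finset.smul_sum]
    exact Finset.sum_congr rfl fun i _ => smul_comm _ _ _
  rw [this, smul_eq_zero_iff_right hr]

lemma prod_le_one_of_sum_eq_one {n : ℕ} {p : ℕ → ℝ} (h0 : ∀ i ∈ Finset.Icc 1 n, 0 ≤ p i)
    (h1 : ∑ i ∈ Finset.Icc 1 n, p i = 1) : ∏ i ∈ Finset.Icc 1 n, p i ≤ 1 :=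
  Finset.prod_le_one h0 fun _ hi => h1 ▸ Finset.single_le_sum h0 hi

lemma seqLikelihood_bddAbove {d : ℕ} (n : ℕ) (T : ℕ → E d) :
    BddAbove {L : ℝ | ∃ p : ℕ → ℝ, (∀ i ∈ Finset.Icc 1 n, 0 ≤ p i) ∧
    ∑ i ∈ Finset.Icc 1 n, p i = 1 ∧
    ∑ i ∈ Finset.Icc 1 n, p i • T i = 0 ∧
    L = ∏ i ∈ Finset.Icc 1 n, p i} := by
  refine ⟨1, ?_⟩
  rintro _ ⟨p, h0, h1, -, rfl⟩
  exact prod_le_one_of_sum_eq_one h0 h1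

lemma seqLikelihood_nonneg {d : ℕ} (n : ℕ) (T : ℕ → E d) : 0 ≤ seqLikelihood n T := by
  refine Real.sSup_nonneg ?_
  rintro _ ⟨p, h0, -, -, rfl⟩
  exact Finset.prod_nonneg h0

/-- Weak duality for feasible weights. -/
lemma pow_mul_prod_mul_prod_le_one {d n : ℕ} {T : ℕ → E d} {p : ℕ → ℝ} {a : E d}
    (h0 : ∀ i ∈ Finset.Icc 1 n, 0 ≤ p i) (h1 : ∑ i ∈ Finset.Icc 1 n, p i = 1)
    (hT : ∑ i ∈ Finset.Icc 1 n, p i • T i = 0)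
    (ha : ∀ i ∈ Finset.Icc 1 n, 0 ≤ 1 + inner ℝ a (T i)) :
    (n : ℝ) ^ n * (∏ i ∈ Finset.Icc 1 n, p i) * ∏ i ∈ Finset.Icc 1 n, (1 + inner ℝ a (T i)) ≤ 1 := by
  have e1 : (n : ℝ) ^ n * (∏ i ∈ Finset.Icc 1 n, p i) *
      ∏ i ∈ Finset.Icc 1 n, (1 + inner ℝ a (T i)) =
      ∏ i ∈ Finset.Icc 1 n, ((n : ℝ) * p i * (1 + inner ℝ a (T i))) := by
    rw [Finset.prod_mul_distrib, Finset.prod_mul_distrib, Finset.prod_const]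
    simp
  have e2 : ∑ i ∈ Finset.Icc 1 n, p i * (1 + inner ℝ a (T i)) = 1 := by
    have : ∑ i ∈ Finset.Icc 1 n, p i * inner ℝ a (T i) = 0 := by
      have := congrArg (fun v => inner ℝ a v) hT
      simpa [inner_sum, inner_smul_right] using this
    simp [mul_add, Finset.sum_add_distrib, h1, this]
  rw [e1]
  -- Each factor satisfies `x ≤ exp (x - 1)`, and by `e2` the exponents sum to `n - n = 0`.
  calc ∏ i ∈ Finset.Icc 1 n, ((n : ℝ) * p i * (1 + inner ℝ a (T i)))
      ≤ ∏ i ∈ Finset.Icc 1 n, Real.exp ((n : ℝ) * p i * (1 + inner ℝ a (T i)) - 1) := by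
        refine Finset.prod_le_prod (fun i hi => ?_) fun i hi => ?_
        · exact mul_nonneg (mul_nonneg n.cast_nonneg (h0 i hi)) (ha i hi)
        · linarith [Real.add_one_le_exp ((n : ℝ) * p i * (1 + inner ℝ a (T i)) - 1)]
    _ = 1 := by
        rw [← Real.exp_sum, Finset.sum_sub_distrib]
        simp only [mul_assoc]
        rw [← Finset.mul_sum, e2]
        simp

/-- Weak duality. -/
lemma seqLikelihood_mul_prod_le_one {d n : ℕ} {T : ℕ → E d} {a : E d}
    (ha : ∀ i ∈ Finset.Icc 1 n, 0 ≤ 1 + inner ℝ a (T i)) :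
    (n : ℝ) ^ n * seqLikelihood n T * ∏ i ∈ Finset.Icc 1 n, (1 + inner ℝ a (T i)) ≤ 1 := by
  set Q := ∏ i ∈ Finset.Icc 1 n, (1 + inner ℝ a (T i)) with hQ
  have hQ0 : 0 ≤ Q := Finset.prod_nonneg ha
  have hc : 0 ≤ (n : ℝ) ^ n * Q := by positivity
  have : seqLikelihood n T * ((n : ℝ) ^ n * Q) ≤ 1 := by
    rcases hc.eq_or_lt with h | h
    · rw [← h]; simp
    · rw [← le_div_iff₀ h]
      refine Real.sSup_le ?_ (by positivity)
      rintro _ ⟨p, h0, h1, hT, rfl⟩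
      rw [le_div_iff₀ h]
      have := pow_mul_prod_mul_prod_le_one h0 h1 hT ha
      linarith
  linarith

/-- The finite-sample constraint set. -/
def seqConstraint {d : ℕ} (n : ℕ) (T : ℕ → E d) : Set (E d) :=
  {a | ∀ i ∈ Finset.Icc 1 n, 0 ≤ 1 + inner ℝ a (T i)}

lemma isClosed_seqConstraint {d : ℕ} (n : ℕ) (T : ℕ → E d) : IsClosed (seqConstraint n T) := by
  simp only [seqConstraint, Set.ofPred_forall]
  exact isClosed_biInter fun i _ => isClosed_le continuous_const (by fun_prop)

lemma zero_mem_seqConstraint {d : ℕ} (n : ℕ) (T : ℕ → E d) : 0 ∈ seqConstraint n T := by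
  intro i _; simp

/-- First-order condition at an interior maximizer of the dual problem. -/
lemma sum_inv_smul_eq_zero_of_max {d n : ℕ} {T : ℕ → E d} {a : E d}
    (hpos : ∀ i ∈ Finset.Icc 1 n, 0 < 1 + inner ℝ a (T i))
    (hmax : ∀ b ∈ seqConstraint n T, ∏ i ∈ Finset.Icc 1 n, (1 + inner ℝ b (T i)) ≤
      ∏ i ∈ Finset.Icc 1 n, (1 + inner ℝ a (T i))) :
    ∑ i ∈ Finset.Icc 1 n, (1 + inner ℝ a (T i))⁻¹ • T i = 0 := by
  -- The perturbation direction is the gradient itself, so the vanishing derivative equals `⟪v, v⟫`.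
  set v := ∑ i ∈ Finset.Icc 1 n, (1 + inner ℝ a (T i))⁻¹ • T i with hv
  have hev : ∀ᶠ s : ℝ in 𝓝 0, ∀ i ∈ Finset.Icc 1 n, 0 < 1 + inner ℝ (a + s • v) (T i) := by
    rw [Filter.eventually_all_finset]
    intro i hi
    have hc : Continuous fun s : ℝ => 1 + inner ℝ (a + s • v) (T i) := by fun_prop
    exact hc.continuousAt.eventually (lt_mem_nhds (by simpa using hpos i hi))
  have hder : HasDerivAt (fun s : ℝ => ∑ i ∈ Finset.Icc 1 n,
      Real.log (1 + inner ℝ (a + s • v) (T i)))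
      (∑ i ∈ Finset.Icc 1 n, inner ℝ v (T i) / (1 + inner ℝ a (T i))) 0 := by
    refine HasDerivAt.fun_sum fun i hi => ?_
    have h1 : HasDerivAt (fun s : ℝ => 1 + inner ℝ (a + s • v) (T i)) (inner ℝ v (T i)) 0 := by
      have : (fun s : ℝ => 1 + inner ℝ (a + s • v) (T i)) =
          fun s : ℝ => (1 + inner ℝ a (T i)) + s * inner ℝ v (T i) := by
        ext s; rw [inner_add_left, inner_smul_left]; simp; ring
      rw [this]
      simpa using ((hasDerivAt_id (0 : ℝ)).mul_const (inner ℝ v (T i))).const_add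
        (1 + inner ℝ a (T i))
    have := h1.log (by simpa using (hpos i hi).ne')
    simpa using this
  have hloc : IsLocalMax (fun s : ℝ => ∑ i ∈ Finset.Icc 1 n,
      Real.log (1 + inner ℝ (a + s • v) (T i))) 0 := by
    filter_upwards [hev] with s hs
    rw [← Real.log_prod fun i hi => (hs i hi).ne',
      ← Real.log_prod fun i hi => by simpa using (hpos i hi).ne']
    refine Real.log_le_log (Finset.prod_pos hs) ?_
    simpa using hmax (a + s • v) fun i hi => (hs i hi).le
  have h0 := hloc.hasDerivAt_eq_zero hder
  have : inner ℝ v v = 0 := by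
    conv_lhs => rw [hv, inner_sum]
    rw [← h0]
    refine Finset.sum_congr rfl fun i _ => ?_
    rw [inner_smul_right, div_eq_inv_mul]
  exact inner_self_eq_zero.mp this

/-- Strong duality: if the dual constraint set is bounded, then the dual maximum is attained and
equals the negative log likelihood ratio. -/
lemma exists_dual_max {d n : ℕ} (hn : 1 ≤ n) {T : ℕ → E d}
    (hb : Bornology.IsBounded (seqConstraint n T)) :
    ∃ a ∈ seqConstraint n T,
      (∀ i ∈ Finset.Icc 1 n, 0 < 1 + inner ℝ a (T i)) ∧
      (∀ b ∈ seqConstraint n T, ∏ i ∈ Finset.Icc 1 n, (1 + inner ℝ b (T i)) ≤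
        ∏ i ∈ Finset.Icc 1 n, (1 + inner ℝ a (T i))) ∧
      seqNegLog n T =
        (((n : ℝ)⁻¹ * ∑ i ∈ Finset.Icc 1 n, Real.log (1 + inner ℝ a (T i)) : ℝ) : EReal) := by
  have hK : IsCompact (seqConstraint n T) :=
    Metric.isCompact_of_isClosed_isBounded (isClosed_seqConstraint n T) hb
  have hcont : Continuous fun b : E d => ∏ i ∈ Finset.Icc 1 n, (1 + inner ℝ b (T i)) := by fun_prop
  obtain ⟨a, haK, hmax⟩ := hK.exists_isMaxOn ⟨0, zero_mem_seqConstraint n T⟩ hcont.continuousOn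
  have hmax' : ∀ b ∈ seqConstraint n T, ∏ i ∈ Finset.Icc 1 n, (1 + inner ℝ b (T i)) ≤
        ∏ i ∈ Finset.Icc 1 n, (1 + inner ℝ a (T i)) := fun b hb => hmax hb
  -- The point `0` is feasible with product `1`, so no factor vanishes at the maximizer.
  have hprod : 0 < ∏ i ∈ Finset.Icc 1 n, (1 + inner ℝ a (T i)) := by
    have := hmax' 0 (zero_mem_seqConstraint n T)
    simp only [inner_zero_left, add_zero, Finset.prod_const_one] at this
    linarith
  have hpos : ∀ i ∈ Finset.Icc 1 n, 0 < 1 + inner ℝ a (T i) := fun i hi =>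
    lt_of_le_of_ne (haK i hi) fun h =>
      hprod.ne' (Finset.prod_eq_zero hi h.symm)
  refine ⟨a, haK, hpos, hmax', ?_⟩
  have hn0 : (n : ℝ) ≠ 0 := by positivity
  have hfoc := sum_inv_smul_eq_zero_of_max hpos hmax'
  have hval : (n : ℝ) ^ n * seqLikelihood n T = (∏ i ∈ Finset.Icc 1 n, (1 + inner ℝ a (T i)))⁻¹ := by
    refine le_antisymm ?_ ?_
    · rw [← one_div, le_div_iff₀ hprod]
      exact seqLikelihood_mul_prod_le_one haK
    -- The weights `p_i = 1 / (n (1 + a' T_i))` attain the dual bound; the first-order condition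
    -- gives both of their linear constraints.
    · have : ∏ i ∈ Finset.Icc 1 n, ((n : ℝ)⁻¹ * (1 + inner ℝ a (T i))⁻¹) ≤ seqLikelihood n T := by
        refine le_csSup (seqLikelihood_bddAbove n T) ⟨_, fun i hi => ?_, ?_, ?_, rfl⟩
        · have := hpos i hi
          positivity
        · have h1 : ∑ i ∈ Finset.Icc 1 n, (1 + inner ℝ a (T i))⁻¹ * inner ℝ a (T i) = 0 := by
            have := congrArg (fun v => inner ℝ a v) hfoc
            simpa [inner_sum, inner_smul_right] using this
          have h2 : ∀ i ∈ Finset.Icc 1 n, (1 + inner ℝ a (T i))⁻¹ =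
              1 - (1 + inner ℝ a (T i))⁻¹ * inner ℝ a (T i) := by
            intro i hi
            have := (hpos i hi).ne'
            field_simp
            ring
          rw [← Finset.mul_sum, Finset.sum_congr rfl h2, Finset.sum_sub_distrib, h1]
          simp [hn0]
        · simp only [mul_smul]
          rw [← Finset.smul_sum, hfoc, smul_zero]
      rw [Finset.prod_mul_distrib, Finset.prod_const, Finset.prod_inv_distrib] at this
      simp only [Nat.card_Icc, add_tsub_cancel_right] at this
      calc (∏ i ∈ Finset.Icc 1 n, (1 + inner ℝ a (T i)))⁻¹
          = (n : ℝ) ^ n * ((n : ℝ)⁻¹ ^ n * (∏ i ∈ Finset.Icc 1 n, (1 + inner ℝ a (T i)))⁻¹) := by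
            rw [inv_pow, mul_inv_cancel_left₀ (pow_ne_zero _ hn0)]
        _ ≤ _ := by gcongr
  rw [seqNegLog, hval, ENNReal.log_ofReal_of_pos (inv_pos.mpr hprod), Real.log_inv,
    ← EReal.coe_mul, ← EReal.coe_neg, Real.log_prod fun i hi => (hpos i hi).ne']
  congr 1
  ring

/-! ### Measurability of the likelihood -/

/-- A superlevel set is a countable union of projections of closed sets along the compact cube of
weights, and such projections are closed. The margin `1 / (k + 1)` makes the strict inequality a
closed condition; `c ≥ 0` excludes the default value `sSup ∅ = 0`. -/
lemma measurable_seqLikelihood {d : ℕ} (n : ℕ) : Measurable (seqLikelihood (d := d) n) := by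
  refine measurable_of_Ioi fun c => ?_
  rcases lt_or_ge c 0 with hc | hc
  · convert MeasurableSet.univ
    ext T
    simpa using hc.trans_le (seqLikelihood_nonneg n T)
  set Q : Set (ℕ → ℝ) := Set.univ.pi fun _ => Set.Icc 0 1
  have hQ : IsCompact Q := isCompact_univ_pi fun _ => isCompact_Icc
  set F : ℕ → Set (Q × (ℕ → E d)) := fun k =>
    {q | ∑ i ∈ Finset.Icc 1 n, (q.1 : ℕ → ℝ) i = 1} ∩
      ({q | ∑ i ∈ Finset.Icc 1 n, (q.1 : ℕ → ℝ) i • q.2 i = 0} ∩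
      {q | c + 1 / ((k : ℝ) + 1) ≤ ∏ i ∈ Finset.Icc 1 n, (q.1 : ℕ → ℝ) i}) with hF
  have hFc : ∀ k, IsClosed (F k) := by
    intro k
    have hc1 : ∀ i, Continuous fun q : Q × (ℕ → E d) => (q.1 : ℕ → ℝ) i := fun i =>
      (continuous_apply i).comp (continuous_subtype_val.comp continuous_fst)
    have hc2 : ∀ i, Continuous fun q : Q × (ℕ → E d) => q.2 i := fun i =>
      (continuous_apply i).comp continuous_snd
    exact (isClosed_eq (continuous_finsetSum _ fun i _ => hc1 i) continuous_const).inter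
      ((isClosed_eq (continuous_finsetSum _ fun i _ => (hc1 i).smul (hc2 i))
        continuous_const).inter
        (isClosed_le continuous_const (continuous_finsetProd _ fun i _ => hc1 i)))
  have : CompactSpace Q := isCompact_iff_compactSpace.mp hQ
  have key : seqLikelihood (d := d) n ⁻¹' Set.Ioi c = ⋃ k, Prod.snd '' F k := by
    ext T
    simp only [Set.mem_preimage, Set.mem_Ioi, Set.mem_iUnion, Set.mem_image]
    constructor
    · intro h
      have hne : {L : ℝ | ∃ p : ℕ → ℝ, (∀ i ∈ Finset.Icc 1 n, 0 ≤ p i) ∧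
          ∑ i ∈ Finset.Icc 1 n, p i = 1 ∧ ∑ i ∈ Finset.Icc 1 n, p i • T i = 0 ∧
          L = ∏ i ∈ Finset.Icc 1 n, p i}.Nonempty := by
        by_contra hne
        rw [Set.not_nonempty_iff_eq_empty] at hne
        rw [seqLikelihood, hne, Real.sSup_empty] at h
        exact absurd h hc.not_gt
      obtain ⟨_, ⟨p, h0, h1, h2, rfl⟩, hlt⟩ := exists_lt_of_lt_csSup hne h
      obtain ⟨k, hk⟩ := exists_nat_one_div_lt (sub_pos.mpr hlt)
      have hp' : ∀ i ∈ Finset.Icc 1 n, (if i ∈ Finset.Icc 1 n then p i else 0) = p i :=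
        fun i hi => if_pos hi
      -- Weights outside `1, …, n` are arbitrary in the definition; they are set to `0` to lie in
      -- the cube.
      refine ⟨k, ⟨⟨fun i => if i ∈ Finset.Icc 1 n then p i else 0, ?_⟩, T⟩, ⟨?_, ?_, ?_⟩, rfl⟩
      · intro i _
        dsimp only
        split_ifs with hi
        · exact ⟨h0 i hi, h1 ▸ Finset.single_le_sum h0 hi⟩
        · simp
      · exact (Finset.sum_congr rfl hp').trans h1
      · exact (Finset.sum_congr rfl fun i hi => congrArg (· • T i) (hp' i hi)).trans h2
      · refine le_of_le_of_eq ?_ (Finset.prod_congr rfl hp').symm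
        linarith
    · rintro ⟨k, ⟨⟨p, hp⟩, T'⟩, ⟨h1, h2, h3⟩, rfl⟩
      have : (0 : ℝ) < 1 / ((k : ℝ) + 1) := by positivity
      refine lt_of_lt_of_le (by linarith) (h3.trans (le_csSup (seqLikelihood_bddAbove n T')
        ⟨p, fun i _ => (hp i trivial).1, h1, h2, rfl⟩))
  rw [key]
  exact MeasurableSet.iUnion fun k => (isClosedMap_snd_of_compactSpace _ (hFc k)).measurableSet

lemma measurable_seqNegLog {d : ℕ} (n : ℕ) : Measurable (seqNegLog (d := d) n) := by
  have h1 : Measurable fun T : ℕ → E d =>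
      ENNReal.log (ENNReal.ofReal ((n : ℝ) ^ n * seqLikelihood n T)) :=
    ENNReal.measurable_log.comp ((measurable_seqLikelihood n).const_mul _).ennreal_ofReal
  exact (h1.const_mul _).neg

/-! ### Grid averages of continuous functions -/

/-- The point `i / n` of the unit interval. -/
noncomputable def gridPoint (n i : ℕ) : I := Set.projIcc 0 1 zero_le_one ((i : ℝ) / n)

lemma coe_gridPoint {n i : ℕ} (hi : i ∈ Finset.Icc 1 n) : (gridPoint n i : ℝ) = (i : ℝ) / n := by
  rw [Finset.mem_Icc] at hi
  have hn : (0 : ℝ) < n := by exact_mod_cast (by omega : 0 < n)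
  have : ((i : ℝ) / n) ∈ Set.Icc (0 : ℝ) 1 :=
    ⟨by positivity, by rw [div_le_one hn]; exact_mod_cast hi.2⟩
  rw [gridPoint, Set.projIcc_of_mem _ this]

/-- The average of `h` over the grid `1 / n, …, n / n`. -/
noncomputable def gridAvg (n : ℕ) (h : C(I, ℝ)) : ℝ :=
  (n : ℝ)⁻¹ * ∑ i ∈ Finset.Icc 1 n, h (gridPoint n i)

lemma abs_gridAvg_sub_le (n : ℕ) (h h' : C(I, ℝ)) : |gridAvg n h - gridAvg n h'| ≤ ‖h - h'‖ := by
  rcases Nat.eq_zero_or_pos n with rfl | hn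
  · simp [gridAvg]
  have hn' : (0 : ℝ) < n := by exact_mod_cast hn
  rw [gridAvg, gridAvg, ← mul_sub, ← Finset.sum_sub_distrib, abs_mul, abs_of_pos (inv_pos.mpr hn'),
    inv_mul_le_iff₀ hn']
  calc |∑ i ∈ Finset.Icc 1 n, (h (gridPoint n i) - h' (gridPoint n i))|
      ≤ ∑ i ∈ Finset.Icc 1 n, |h (gridPoint n i) - h' (gridPoint n i)| :=
        Finset.abs_sum_le_sum_abs _ _
    _ ≤ ∑ i ∈ Finset.Icc 1 n, ‖h - h'‖ :=
        Finset.sum_le_sum fun i _ => (h - h').norm_coe_le_norm (gridPoint n i)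
    _ = n * ‖h - h'‖ := by simp

lemma integral_unitInterval_eq (h : C(I, ℝ)) :
    ∫ t, h t = ∫ x in (0 : ℝ)..1, h (Set.projIcc 0 1 zero_le_one x) := by
  rw [intervalIntegral.integral_of_le zero_le_one, ← integral_Icc_eq_integral_Ioc,
    ← integral_subtype_comap measurableSet_Icc]
  refine integral_congr_ae (Eventually.of_forall fun t => ?_)
  simp only [Set.projIcc_val]

lemma tendsto_gridAvg (h : C(I, ℝ)) : Tendsto (fun n => gridAvg n h) atTop (𝓝 (∫ t, h t)) := by
  set H : ℝ → ℝ := fun x => h (Set.projIcc 0 1 zero_le_one x) with hH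
  have hHc : Continuous H := h.continuous.comp continuous_projIcc
  have huc : UniformContinuousOn H (Set.Icc 0 1) :=
    isCompact_Icc.uniformContinuousOn_of_continuous hHc.continuousOn
  rw [integral_unitInterval_eq, Metric.tendsto_atTop]
  intro ε hε
  obtain ⟨δ, hδ, hδ'⟩ := Metric.uniformContinuousOn_iff.mp huc (ε / 2) (by positivity)
  obtain ⟨N, hN⟩ := exists_nat_one_div_lt hδ
  refine ⟨N + 1, fun n hn => ?_⟩
  have hn' : (0 : ℝ) < n := by exact_mod_cast (by omega : 0 < n)
  have hnδ : 1 / (n : ℝ) < δ := by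
    refine lt_of_le_of_lt ?_ hN
    exact one_div_le_one_div_of_le (by positivity) (by exact_mod_cast hn)
  have e1 : gridAvg n h = ∑ i ∈ Finset.range n,
      ∫ _ in ((i : ℝ) / n)..(((i + 1 : ℕ) : ℝ) / n), H (((i + 1 : ℕ) : ℝ) / n) := by
    simp only [intervalIntegral.integral_const, smul_eq_mul]
    have hs := Finset.sum_Ico_add' (fun j : ℕ => (n : ℝ)⁻¹ * h (gridPoint n j)) 0 n 1
    rw [← Finset.range_eq_Ico] at hs
    rw [gridAvg, Finset.mul_sum]
    refine Eq.trans (b := ∑ j ∈ Finset.Ico (0 + 1) (n + 1), (n : ℝ)⁻¹ * h (gridPoint n j)) ?_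
      (hs.symm.trans ?_)
    · rfl
    · refine Finset.sum_congr rfl fun i _ => ?_
      rw [hH, gridPoint]
      push_cast
      congr 1
      field_simp
      ring
  have e2 : ∫ x in (0 : ℝ)..1, H x = ∑ i ∈ Finset.range n,
      ∫ x in ((i : ℝ) / n)..(((i + 1 : ℕ) : ℝ) / n), H x := by
    rw [intervalIntegral.sum_integral_adjacent_intervals (a := fun i : ℕ => (i : ℝ) / n)
      fun k _ => hHc.intervalIntegrable _ _]
    simp [hn'.ne']
  have e3 : ∀ i ∈ Finset.range n,
      ‖(∫ _ in ((i : ℝ) / n)..(((i + 1 : ℕ) : ℝ) / n), H (((i + 1 : ℕ) : ℝ) / n)) -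
        ∫ x in ((i : ℝ) / n)..(((i + 1 : ℕ) : ℝ) / n), H x‖ ≤ ε / 2 * (1 / n) := by
    intro i hi
    rw [Finset.mem_range] at hi
    have hlen : ((i + 1 : ℕ) : ℝ) / n - (i : ℝ) / n = 1 / n := by push_cast; ring
    rw [← intervalIntegral.integral_sub intervalIntegrable_const (hHc.intervalIntegrable _ _)]
    refine (intervalIntegral.norm_integral_le_of_norm_le_const (C := ε / 2) fun x hx => ?_).trans
      (by rw [hlen, abs_of_pos (by positivity)])
    have hle : (i : ℝ) / n ≤ ((i + 1 : ℕ) : ℝ) / n := by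
      have : (0 : ℝ) < 1 / n := by positivity
      linarith
    rw [Set.uIoc_of_le hle] at hx
    have h0 : (0 : ℝ) ≤ (i : ℝ) / n := by positivity
    have h1 : ((i + 1 : ℕ) : ℝ) / n ≤ 1 := by
      rw [div_le_one hn']; exact_mod_cast hi
    rw [← dist_eq_norm]
    refine (hδ' _ ⟨by linarith [hx.1, hx.2], h1⟩ _ ⟨by linarith [hx.1], by linarith [hx.2]⟩ ?_).le
    rw [Real.dist_eq, abs_of_nonneg (by linarith [hx.2])]
    linarith [hx.1]
  rw [dist_eq_norm, e1, e2, ← Finset.sum_sub_distrib]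
  calc _ ≤ ∑ i ∈ Finset.range n, ε / 2 * (1 / n) := norm_sum_le_of_le _ e3
    _ = ε / 2 := by simp; field_simp
    _ < ε := by linarith

lemma tendsto_gridAvg_of_tendsto {φ : ℕ → ℕ} (hφ : Tendsto φ atTop atTop) {h : ℕ → C(I, ℝ)}
    {g : C(I, ℝ)} (hh : Tendsto h atTop (𝓝 g)) :
    Tendsto (fun k => gridAvg (φ k) (h k)) atTop (𝓝 (∫ t, g t)) := by
  have h1 := (tendsto_gridAvg g).comp hφ
  have h2 : Tendsto (fun k => gridAvg (φ k) (h k) - gridAvg (φ k) g) atTop (𝓝 0) :=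
    squeeze_zero_norm (fun k => abs_gridAvg_sub_le _ _ _) (tendsto_iff_norm_sub_tendsto_zero.mp hh)
  simpa using h2.add h1

/-! ### Truncated logarithms and the objective -/

/-- The logarithm truncated from below at level `1 / (k + 1)`. -/
noncomputable def truncLog (k : ℕ) (x : ℝ) : ℝ := Real.log (max x (1 / ((k : ℝ) + 1)))

lemma continuous_truncLog (k : ℕ) : Continuous (truncLog k) := by
  refine Continuous.log (by fun_prop) fun x => ?_
  exact (lt_max_of_lt_right (by positivity)).ne'

lemma truncLog_antitone (x : ℝ) : Antitone fun k => truncLog k x := by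
  intro k l hkl
  refine Real.log_le_log (lt_max_of_lt_right (by positivity)) (max_le_max le_rfl ?_)
  exact one_div_le_one_div_of_le (by positivity) (by gcongr)

lemma log_le_truncLog (k : ℕ) {x : ℝ} (hx : 0 < x) : Real.log x ≤ truncLog k x :=
  Real.log_le_log hx (le_max_left _ _)

/-- The truncation level is at most `1`, so only the negative part of the logarithm is affected. -/
lemma ofReal_truncLog (k : ℕ) (x : ℝ) :
    ENNReal.ofReal (truncLog k x) = (ENNReal.log (ENNReal.ofReal x)).toENNReal := by
  have hk : (1 : ℝ) / ((k : ℝ) + 1) ≤ 1 := by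
    rw [div_le_one (by positivity)]; linarith [(Nat.cast_nonneg k : (0 : ℝ) ≤ k)]
  have hk0 : (0 : ℝ) < 1 / ((k : ℝ) + 1) := by positivity
  rcases le_or_gt x 1 with hx | hx
  · rw [truncLog, ENNReal.ofReal_of_nonpos (Real.log_nonpos (le_max_of_le_right hk0.le) (max_le hx hk)),
      EReal.toENNReal_of_nonpos]
    rw [ENNReal.log_le_zero_iff]
    exact ENNReal.ofReal_le_one.mpr hx
  · rw [truncLog, max_eq_left (hk.trans hx.le), ENNReal.log_ofReal_of_pos (by linarith),
      EReal.toENNReal_of_ne_top (EReal.coe_ne_top _), EReal.toReal_coe]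

lemma tendsto_ofReal_neg_truncLog (x : ℝ) :
    Tendsto (fun k => ENNReal.ofReal (-truncLog k x)) atTop
      (𝓝 (-ENNReal.log (ENNReal.ofReal x)).toENNReal) := by
  rcases le_or_gt x 0 with hx | hx
  · rw [ENNReal.ofReal_of_nonpos hx]
    simp only [ENNReal.log_zero, EReal.neg_bot, EReal.toENNReal_top]
    refine ENNReal.tendsto_ofReal_nhds_top.mpr ?_
    have : ∀ k : ℕ, -truncLog k x = Real.log ((k : ℝ) + 1) := by
      intro k
      rw [truncLog, max_eq_right (hx.trans (by positivity)), one_div, Real.log_inv, neg_neg]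
    simp only [this]
    exact Real.tendsto_log_atTop.comp
      (tendsto_natCast_atTop_atTop.atTop_add (tendsto_const_nhds (x := (1 : ℝ))))
  · rw [ENNReal.log_ofReal_of_pos hx, ← EReal.coe_neg,
      EReal.toENNReal_of_ne_top (EReal.coe_ne_top _), EReal.toReal_coe]
    refine tendsto_const_nhds.congr' ?_
    obtain ⟨N, hN⟩ := exists_nat_one_div_lt hx
    filter_upwards [eventually_ge_atTop N] with k hk
    rw [truncLog, max_eq_left]
    exact (one_div_le_one_div_of_le (by positivity) (by gcongr)).trans hN.le

/-- The path `t ↦ log (max (1 + a' f(t)) (1 / (k + 1)))`. -/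
noncomputable def truncLogPath {d : ℕ} (k : ℕ) (a : E d) (f : C(I, E d)) : C(I, ℝ) where
  toFun t := truncLog k (1 + inner ℝ a (f t))
  continuous_toFun := (continuous_truncLog k).comp (by fun_prop)

lemma continuous_truncLogPath {d : ℕ} (k : ℕ) :
    Continuous fun q : E d × C(I, E d) => truncLogPath k q.1 q.2 := by
  refine ContinuousMap.continuous_of_continuous_uncurry _ ?_
  change Continuous fun r : (E d × C(I, E d)) × I => truncLog k (1 + inner ℝ r.1.1 (r.1.2 r.2))
  exact (continuous_truncLog k).comp (by fun_prop)

lemma integrable_path (h : C(I, ℝ)) : Integrable (fun t => h t) :=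
  h.continuous.integrable_of_hasCompactSupport (HasCompactSupport.of_compactSpace _)

/-- Monotone convergence applies to the negative part. The positive part does not depend on `k` and
is finite, so the subtraction in `EReal` is continuous at the limit. -/
lemma tendsto_neg_integral_truncLogPath {d : ℕ} (f : C(I, E d)) (a : E d) :
    Tendsto (fun k => ((-∫ t, truncLogPath k a f t : ℝ) : EReal)) atTop (𝓝 (objective f a)) := by
  set h : I → ℝ := fun t => 1 + inner ℝ a (f t) with hh
  set Pp : ℝ≥0∞ := ∫⁻ t : I, (ENNReal.log (ENNReal.ofReal (h t))).toENNReal with hPp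
  have hpos : ∀ k, ∫⁻ t : I, ENNReal.ofReal (truncLogPath k a f t) = Pp := fun k =>
    lintegral_congr fun t => ofReal_truncLog k (h t)
  have hPfin : Pp ≠ ⊤ := by
    rw [← hpos 0]
    exact (integrable_path (truncLogPath 0 a f)).lintegral_lt_top.ne
  have hint : ∀ k, ((-∫ t, truncLogPath k a f t : ℝ) : EReal) =
      ((∫⁻ t : I, ENNReal.ofReal (-truncLogPath k a f t) : ℝ≥0∞) : EReal) + -(Pp : EReal) := by
    intro k
    have hN : ∫⁻ t : I, ENNReal.ofReal (-truncLogPath k a f t) ≠ ⊤ :=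
      (integrable_path (truncLogPath k a f)).neg.lintegral_lt_top.ne
    rw [integral_eq_lintegral_pos_part_sub_lintegral_neg_part (integrable_path _), hpos,
      neg_sub, EReal.coe_sub, EReal.coe_ennreal_toReal hN, EReal.coe_ennreal_toReal hPfin,
      sub_eq_add_neg]
  have hlim : Tendsto (fun k => ∫⁻ t : I, ENNReal.ofReal (-truncLogPath k a f t)) atTop
      (𝓝 (∫⁻ t : I, (-ENNReal.log (ENNReal.ofReal (h t))).toENNReal)) := by
    refine lintegral_tendsto_of_tendsto_of_monotone (fun k => ?_)
      (Eventually.of_forall fun t k l hkl => ?_)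
      (Eventually.of_forall fun t => tendsto_ofReal_neg_truncLog (h t))
    · exact (ENNReal.continuous_ofReal.comp
        (truncLogPath k a f).continuous.neg).measurable.aemeasurable
    · exact ENNReal.ofReal_le_ofReal (neg_le_neg (truncLog_antitone _ hkl))
  simp only [hint]
  change Tendsto _ _ (𝓝 ((_ : EReal) - (Pp : EReal)))
  rw [sub_eq_add_neg]
  have hP : -(Pp : EReal) = ((-Pp.toReal : ℝ) : EReal) := by
    rw [EReal.coe_neg, EReal.coe_ennreal_toReal hPfin]
  rw [hP]
  have hc : ContinuousAt (fun p : EReal × EReal => p.1 + p.2)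
      (((∫⁻ t : I, (-ENNReal.log (ENNReal.ofReal (h t))).toENNReal : ℝ≥0∞) : EReal),
        ((-Pp.toReal : ℝ) : EReal)) :=
    EReal.continuousAt_add (Or.inr (EReal.coe_ne_bot _)) (Or.inr (EReal.coe_ne_top _))
  exact hc.tendsto.comp
    ((((continuous_coe_ennreal_ereal.tendsto _).comp hlim)).prodMk_nhds tendsto_const_nhds)

lemma monotone_neg_integral_truncLogPath {d : ℕ} (f : C(I, E d)) (a : E d) :
    Monotone fun k => ((-∫ t, truncLogPath k a f t : ℝ) : EReal) := by
  intro k l hkl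
  rw [EReal.coe_le_coe_iff]
  exact neg_le_neg (integral_mono (integrable_path _) (integrable_path _)
    fun t => truncLog_antitone _ hkl)

lemma objective_eq_iSup {d : ℕ} (f : C(I, E d)) (a : E d) :
    objective f a = ⨆ k, ((-∫ t, truncLogPath k a f t : ℝ) : EReal) :=
  tendsto_nhds_unique (tendsto_neg_integral_truncLogPath f a)
    (tendsto_atTop_iSup (monotone_neg_integral_truncLogPath f a))

lemma continuous_integral_truncLogPath {d : ℕ} (k : ℕ) :
    Continuous fun q : E d × C(I, E d) => ∫ t, truncLogPath k q.1 q.2 t := by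
  have h1 : Continuous fun h : C(I, ℝ) => ∫ t, h t := by
    refine (LipschitzWith.of_dist_le_mul (K := 1) fun h h' => ?_).continuous
    rw [dist_eq_norm, ← integral_sub (integrable_path h) (integrable_path h'), NNReal.coe_one,
      one_mul, dist_eq_norm]
    refine (norm_integral_le_of_norm_le_const (C := ‖h - h'‖)
      (Eventually.of_forall fun t => (h - h').norm_coe_le_norm t)).trans (by simp)
  exact h1.comp (continuous_truncLogPath k)

/-- The objective is a supremum of functions continuous in `a`. -/
lemma lowerSemicontinuous_objective {d : ℕ} (f : C(I, E d)) :
    LowerSemicontinuous (objective f) := by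
  have : objective f = fun a => ⨆ k, ((-∫ t, truncLogPath k a f t : ℝ) : EReal) :=
    funext (objective_eq_iSup f)
  rw [this]
  refine lowerSemicontinuous_iSup fun k => Continuous.lowerSemicontinuous ?_
  exact continuous_coe_real_ereal.comp
    ((continuous_integral_truncLogPath k).comp (Continuous.prodMk_left f)).neg

/-! ### Paths that positively span the space -/

/-- The values of the path are not contained in a closed half-space through the origin. -/
def Spans {d : ℕ} (f : I → E d) : Prop := ∀ a : E d, a ≠ 0 → ∃ t, inner ℝ a (f t) < 0

/-- The index `i` of a grid point `i / n` close to `t`. -/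
noncomputable def nearIndex (n : ℕ) (t : I) : ℕ := min n (⌊(n : ℝ) * t⌋₊ + 1)

lemma nearIndex_mem {n : ℕ} (hn : 1 ≤ n) (t : I) : nearIndex n t ∈ Finset.Icc 1 n := by
  rw [Finset.mem_Icc, nearIndex]
  omega

lemma tendsto_gridPoint_nearIndex (t : I) :
    Tendsto (fun n => gridPoint n (nearIndex n t)) atTop (𝓝 t) := by
  rw [tendsto_subtype_rng]
  have h0 : Tendsto (fun n : ℕ => 1 / (n : ℝ)) atTop (𝓝 0) := tendsto_one_div_atTop_nhds_zero_nat
  refine tendsto_iff_norm_sub_tendsto_zero.mpr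
    (squeeze_zero' (Eventually.of_forall fun _ => norm_nonneg _) ?_ h0)
  filter_upwards [eventually_ge_atTop 1] with n hn
  have hn' : (0 : ℝ) < n := by exact_mod_cast hn
  have ht : (n : ℝ) * t ≤ n := mul_le_of_le_one_right hn'.le t.2.2
  have h1 := Nat.floor_le (mul_nonneg hn'.le t.2.1)
  have h2 := Nat.lt_floor_add_one ((n : ℝ) * t)
  rw [coe_gridPoint (nearIndex_mem hn t), Real.norm_eq_abs, nearIndex]
  push_cast
  rw [← abs_of_pos hn', ← mul_le_mul_iff_right₀ (abs_pos.mpr hn'.ne'), ← abs_mul, abs_of_pos hn',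
    mul_one_div_cancel hn'.ne', mul_sub, mul_div_cancel₀ _ hn'.ne', abs_le]
  constructor
  · rw [le_sub_iff_add_le, le_min_iff]
    constructor <;> linarith
  · linarith [min_le_right (n : ℝ) (⌊(n : ℝ) * t⌋₊ + 1)]

lemma tendsto_eval_nearIndex {d : ℕ} {φ : ℕ → ℕ} (hφ : Tendsto φ atTop atTop)
    {f : ℕ → C(I, E d)} {g : C(I, E d)} (hf : Tendsto f atTop (𝓝 g)) (t : I) :
    Tendsto (fun k => f k (gridPoint (φ k) (nearIndex (φ k) t))) atTop (𝓝 (g t)) := by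
  have hc : Continuous fun q : C(I, E d) × I => q.1 q.2 := by fun_prop
  exact (hc.tendsto (g, t)).comp (hf.prodMk_nhds ((tendsto_gridPoint_nearIndex t).comp hφ))

/-- The sequence of grid values of a path. -/
noncomputable def gridValues {d : ℕ} (n : ℕ) (f : C(I, E d)) (i : ℕ) : E d := f (gridPoint n i)

/-- Otherwise feasible `a` with `‖a‖ → ∞` exist along a subsequence. Dividing the constraints by
`‖a‖` leaves, in the limit, a unit vector `u` with `u' g ≥ 0` everywhere, against `Spans g`. -/
lemma eventually_seqConstraint_norm_le {d : ℕ} {f : ℕ → C(I, E d)} {g : C(I, E d)}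
    (hf : Tendsto f atTop (𝓝 g)) (hg : Spans g) :
    ∃ R : ℝ, ∀ᶠ n in atTop, ∀ a ∈ seqConstraint n (gridValues n (f n)), ‖a‖ ≤ R := by
  by_contra! hcon
  have hcon' : ∀ m : ℕ, ∃ᶠ n in atTop,
      ∃ a ∈ seqConstraint n (gridValues n (f n)), (m : ℝ) < ‖a‖ := by
    intro m
    refine (hcon m).mono fun n hn => ?_
    simpa using hn
  obtain ⟨φ, hφ, hP⟩ := extraction_forall_of_frequently hcon'
  choose a haK han using hP
  have hapos : ∀ m, 0 < ‖a m‖ := fun m => lt_of_le_of_lt (Nat.cast_nonneg m) (han m)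
  have hu : ∀ m, ‖a m‖⁻¹ • a m ∈ Metric.sphere (0 : E d) 1 := by
    intro m
    simp [norm_smul, (hapos m).ne']
  obtain ⟨u, hus, ψ, hψ, hlim⟩ := (isCompact_sphere (0 : E d) 1).tendsto_subseq hu
  have hu0 : u ≠ 0 := by
    rintro rfl
    simp at hus
  obtain ⟨t, ht⟩ := hg u hu0
  have hφψ : Tendsto (fun j => φ (ψ j)) atTop atTop :=
    hφ.tendsto_atTop.comp hψ.tendsto_atTop
  have hev := tendsto_eval_nearIndex hφψ (hf.comp hφψ) t
  have hin := hlim.inner (𝕜 := ℝ) hev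
  have hinv : Tendsto (fun j => -(‖a (ψ j)‖)⁻¹) atTop (𝓝 (-0)) := by
    refine (tendsto_inv_atTop_zero.comp ?_).neg
    refine tendsto_atTop_mono (fun j => (han (ψ j)).le) ?_
    exact tendsto_natCast_atTop_atTop.comp hψ.tendsto_atTop
  rw [neg_zero] at hinv
  refine absurd (le_of_tendsto_of_tendsto hinv hin ?_) ht.not_ge
  filter_upwards [hφψ.eventually_ge_atTop 1] with j hj
  have h1 := haK (ψ j) _ (nearIndex_mem hj t)
  simp only [Function.comp, inner_smul_left, gridValues] at h1 ⊢
  have h2 := mul_le_mul_of_nonneg_left h1 (inv_pos.mpr (hapos (ψ j))).le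
  simp only [conj_trivial]
  linarith

lemma mem_constraintSet_of_tendsto {d : ℕ} {φ : ℕ → ℕ} (hφ : Tendsto φ atTop atTop)
    {f : ℕ → C(I, E d)} {g : C(I, E d)} (hf : Tendsto f atTop (𝓝 g)) {a : ℕ → E d} {b : E d}
    (ha : ∀ k, a k ∈ seqConstraint (φ k) (gridValues (φ k) (f k)))
    (hab : Tendsto a atTop (𝓝 b)) : b ∈ constraintSet g := by
  intro t
  refine ge_of_tendsto ((hab.inner (𝕜 := ℝ) (tendsto_eval_nearIndex hφ hf t)).const_add 1) ?_
  filter_upwards [hφ.eventually_ge_atTop 1] with k hk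
  exact ha k _ (nearIndex_mem hk t)

lemma isCompact_constraintSet {d : ℕ} {g : C(I, E d)} (hg : Spans g) :
    IsCompact (constraintSet g) := by
  refine Metric.isCompact_of_isClosed_isBounded ?_ ?_
  · simp only [constraintSet, Set.ofPred_forall]
    exact isClosed_iInter fun t => isClosed_le continuous_const (by fun_prop)
  -- The constant sequence `g` suffices, since each grid constraint set contains the full one.
  · obtain ⟨R, hR⟩ := eventually_seqConstraint_norm_le (tendsto_const_nhds (x := g)) hg
    obtain ⟨n, hn⟩ := hR.exists
    exact isBounded_iff_forall_norm_le.mpr ⟨R, fun a ha => hn a fun i _ => ha _⟩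

lemma objective_zero {d : ℕ} (g : C(I, E d)) : objective g 0 = 0 := by
  simp [objective]

/-- The minimum of the objective is attained and finite. -/
lemma exists_isLeast_objective {d : ℕ} {g : C(I, E d)} (hg : Spans g) :
    ∃ a ∈ constraintSet g, ∃ m : ℝ, objective g a = m ∧
      ∀ b ∈ constraintSet g, (m : EReal) ≤ objective g b := by
  have h0 : (0 : E d) ∈ constraintSet g := fun t => by simp
  obtain ⟨a, ha, hmin⟩ := ((lowerSemicontinuous_objective g).lowerSemicontinuousOn _).exists_isMinOn
    ⟨0, h0⟩ (isCompact_constraintSet hg)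
  have h1 : objective g a ≤ 0 := (objective_zero g) ▸ hmin h0
  have htop : objective g a ≠ ⊤ := (h1.trans_lt EReal.zero_lt_top).ne
  have hbot : objective g a ≠ ⊥ := by
    rw [objective_eq_iSup]
    exact ((EReal.bot_lt_coe _).trans_le (le_iSup (fun k =>
      ((-∫ t, truncLogPath k a g t : ℝ) : EReal)) 0)).ne'
  refine ⟨a, ha, (objective g a).toReal, (EReal.coe_toReal htop hbot).symm, fun b hb => ?_⟩
  rw [EReal.coe_toReal htop hbot]
  exact hmin hb

lemma neg_integral_truncLogPath_le {d : ℕ} (k : ℕ) (a : E d) (g : C(I, E d)) :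
    ((-∫ t, truncLogPath k a g t : ℝ) : EReal) ≤ objective g a := by
  rw [objective_eq_iSup]
  exact le_iSup (fun k => ((-∫ t, truncLogPath k a g t : ℝ) : EReal)) k

lemma isLeast_objective {d : ℕ} {g : C(I, E d)} (hg : Spans g) :
    ∃ m : ℝ, IsLeast (objective g '' constraintSet g) (m : EReal) := by
  obtain ⟨a, ha, m, hm, hmin⟩ := exists_isLeast_objective hg
  refine ⟨m, ⟨a, ha, hm⟩, ?_⟩
  rintro _ ⟨b, hb, rfl⟩
  exact hmin b hb

/-- Shrinking a feasible point costs at most `-log θ` and gives an interior point. -/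
lemma exists_interior_near_optimal {d : ℕ} {g : C(I, E d)} {a : E d} (ha : a ∈ constraintSet g)
    {m : ℝ} (hm : objective g a = m) {x : ℝ} (hx : x < -m) :
    ∃ (b : E d) (k : ℕ), (∀ t, 2 * (1 / ((k : ℝ) + 1)) < 1 + inner ℝ b (g t)) ∧
      x < ∫ t, truncLogPath k b g t := by
  -- This `θ` spends half of the gap between `x` and `-m`: `log θ - m = (x - m) / 2 > x`.
  set θ := Real.exp ((x + m) / 2) with hθ
  have hθ0 : 0 < θ := Real.exp_pos _
  have hθ1 : θ < 1 := by rw [hθ, Real.exp_lt_one_iff]; linarith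
  obtain ⟨k, hk⟩ := exists_nat_one_div_lt (show 0 < (1 - θ) / 2 by linarith)
  have hk0 : (0 : ℝ) < 1 / ((k : ℝ) + 1) := by positivity
  have hin : ∀ t, 1 + inner ℝ (θ • a) (g t) = (1 - θ) + θ * (1 + inner ℝ a (g t)) := by
    intro t
    rw [inner_smul_left]
    simp
    ring
  have hlow : ∀ t, 1 - θ ≤ 1 + inner ℝ (θ • a) (g t) := by
    intro t
    rw [hin]
    have := mul_nonneg hθ0.le (ha t)
    linarith
  refine ⟨θ • a, k, fun t => by linarith [hlow t], ?_⟩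
  have hpt : ∀ t, Real.log θ + truncLogPath k a g t ≤ truncLogPath k (θ • a) g t := by
    intro t
    have hmax : 0 < max (1 + inner ℝ a (g t)) (1 / ((k : ℝ) + 1)) := lt_max_of_lt_right hk0
    refine le_trans ?_ (log_le_truncLog k (by linarith [hlow t]))
    change Real.log θ + Real.log (max (1 + inner ℝ a (g t)) (1 / ((k : ℝ) + 1))) ≤ _
    rw [← Real.log_mul hθ0.ne' hmax.ne']
    refine Real.log_le_log (by positivity) ?_
    rw [hin, mul_max_of_nonneg _ _ hθ0.le]
    refine max_le (by linarith) ?_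
    have h1 : θ * (1 / ((k : ℝ) + 1)) ≤ 1 / ((k : ℝ) + 1) := mul_le_of_le_one_left hk0.le hθ1.le
    have h2 := mul_nonneg hθ0.le (ha t)
    linarith
  have hint : Real.log θ + ∫ t, truncLogPath k a g t ≤ ∫ t, truncLogPath k (θ • a) g t := by
    have h := integral_mono (((integrable_const (Real.log θ)).add
      (integrable_path (truncLogPath k a g))))
      (integrable_path (truncLogPath k (θ • a) g)) hpt
    rw [integral_add' (integrable_const _) (integrable_path _)] at h
    simpa using h
  have hle := neg_integral_truncLogPath_le k a g
  rw [hm, EReal.coe_le_coe_iff] at hle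
  rw [hθ, Real.log_exp] at hint
  linarith

lemma tendsto_gridAvg_truncLogPath {d : ℕ} (k : ℕ) {φ : ℕ → ℕ} (hφ : Tendsto φ atTop atTop)
    {f : ℕ → C(I, E d)} {g : C(I, E d)} (hf : Tendsto f atTop (𝓝 g)) {a : ℕ → E d} {b : E d}
    (hab : Tendsto a atTop (𝓝 b)) :
    Tendsto (fun j => gridAvg (φ j) (truncLogPath k (a j) (f j))) atTop
      (𝓝 (∫ t, truncLogPath k b g t)) := by
  have h0 : Tendsto (fun j => (a j, f j)) atTop (𝓝 (b, g)) := hab.prodMk_nhds hf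
  have h1 := (continuous_truncLogPath k).tendsto (b, g)
  have h : Tendsto (fun j => truncLogPath k (a j) (f j)) atTop (𝓝 (truncLogPath k b g)) :=
    Tendsto.comp (f := fun j => (a j, f j)) h1 h0
  exact tendsto_gridAvg_of_tendsto hφ h

/-- Uniform convergence of paths implies convergence of the normalized log likelihood ratios. -/
theorem tendsto_seqNegLog {d : ℕ} {f : ℕ → C(I, E d)} {g : C(I, E d)}
    (hf : Tendsto f atTop (𝓝 g)) (hg : Spans g) :
    Tendsto (fun n => seqNegLog n (gridValues n (f n))) atTop (𝓝 (-minObjective g)) := by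
  obtain ⟨a₀, ha₀, m, hm, hmin⟩ := exists_isLeast_objective hg
  have hmo : minObjective g = (m : EReal) := by
    refine IsLeast.csInf_eq ⟨⟨a₀, ha₀, hm⟩, ?_⟩
    rintro _ ⟨b, hb, rfl⟩
    exact hmin b hb
  obtain ⟨R, hR⟩ := eventually_seqConstraint_norm_le hf hg
  obtain ⟨N, hN⟩ := eventually_atTop.mp (hR.and (eventually_ge_atTop 1))
  have hdual : ∀ n, ∃ a, N ≤ n → a ∈ seqConstraint n (gridValues n (f n)) ∧
      (∀ i ∈ Finset.Icc 1 n, 0 < 1 + inner ℝ a (gridValues n (f n) i)) ∧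
      (∀ b ∈ seqConstraint n (gridValues n (f n)),
        ∏ i ∈ Finset.Icc 1 n, (1 + inner ℝ b (gridValues n (f n) i)) ≤
        ∏ i ∈ Finset.Icc 1 n, (1 + inner ℝ a (gridValues n (f n) i))) ∧
      seqNegLog n (gridValues n (f n)) =
        (((n : ℝ)⁻¹ * ∑ i ∈ Finset.Icc 1 n,
          Real.log (1 + inner ℝ a (gridValues n (f n) i)) : ℝ) : EReal) := by
    intro n
    by_cases hn : N ≤ n
    · obtain ⟨a, h1, h2, h3, h4⟩ := exists_dual_max (hN n hn).2
        (isBounded_iff_forall_norm_le.mpr ⟨R, (hN n hn).1⟩)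
      exact ⟨a, fun _ => ⟨h1, h2, h3, h4⟩⟩
    · exact ⟨0, fun h => absurd h hn⟩
  choose a ha using hdual
  set V : ℕ → ℝ := fun n => (n : ℝ)⁻¹ * ∑ i ∈ Finset.Icc 1 n,
    Real.log (1 + inner ℝ (a n) (gridValues n (f n) i)) with hV
  have hVle : ∀ k n, N ≤ n → V n ≤ gridAvg n (truncLogPath k (a n) (f n)) := by
    intro k n hn
    rw [hV, gridAvg]
    dsimp only
    gcongr with i hi
    exact log_le_truncLog k ((ha n hn).2.1 i hi)
  suffices hVlim : Tendsto V atTop (𝓝 (-m)) by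
    rw [hmo, ← EReal.coe_neg]
    refine ((continuous_coe_real_ereal.tendsto _).comp hVlim).congr' ?_
    filter_upwards [eventually_ge_atTop N] with n hn
    exact (ha n hn).2.2.2.symm
  refine tendsto_order.mpr ⟨fun x hx => ?_, fun x hx => ?_⟩
  -- Lower bound: an interior near-optimal `b` for `g` keeps `1 + b' f_n` above the truncation level
  -- for large `n`, so it is feasible and its truncated average is the true one.
  · obtain ⟨b, k, hb, hxb⟩ := exists_interior_near_optimal ha₀ hm hx
    have hk0 : (0 : ℝ) < 1 / ((k : ℝ) + 1) := by positivity
    have hconv : Tendsto (fun n => gridAvg n (truncLogPath k b (f n))) atTop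
        (𝓝 (∫ t, truncLogPath k b g t)) :=
      tendsto_gridAvg_truncLogPath k tendsto_id hf tendsto_const_nhds
    have hnear : ∀ᶠ n in atTop, ‖b‖ * ‖f n - g‖ < 1 / ((k : ℝ) + 1) := by
      have := (tendsto_iff_norm_sub_tendsto_zero.mp hf).const_mul ‖b‖
      rw [mul_zero] at this
      exact this.eventually (gt_mem_nhds hk0)
    filter_upwards [hconv.eventually (lt_mem_nhds hxb), hnear, eventually_ge_atTop N]
      with n h1 h2 hn
    refine h1.trans_le ?_
    have hlow : ∀ t, 1 / ((k : ℝ) + 1) ≤ 1 + inner ℝ b (f n t) := by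
      intro t
      have e1 : |inner ℝ b ((f n - g) t)| ≤ ‖b‖ * ‖f n - g‖ :=
        (abs_real_inner_le_norm _ _).trans (by gcongr; exact (f n - g).norm_coe_le_norm t)
      have e2 : inner ℝ b ((f n - g) t) = inner ℝ b (f n t) - inner ℝ b (g t) := by
        rw [ContinuousMap.sub_apply, inner_sub_right]
      have e3 := (abs_le.mp e1).1
      linarith [hb t]
    have hpos : ∀ i ∈ Finset.Icc 1 n, 0 < 1 + inner ℝ b (gridValues n (f n) i) :=
      fun i _ => hk0.trans_le (hlow _)
    have hmax := (ha n hn).2.2.1 b fun i hi => (hpos i hi).le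
    rw [gridAvg, hV]
    dsimp only
    refine mul_le_mul_of_nonneg_left ?_ (by positivity)
    rw [← Real.log_prod fun i hi => ((ha n hn).2.1 i hi).ne']
    refine le_trans (le_of_eq ?_) (Real.log_le_log (Finset.prod_pos hpos) hmax)
    rw [Real.log_prod fun i hi => (hpos i hi).ne']
    refine Finset.sum_congr rfl fun i _ => ?_
    change Real.log (max _ _) = _
    rw [max_eq_left (hlow _)]
    rfl
  -- Upper bound: a limit point `b` of dual maximizers violating it is feasible for `g`, and `∫
  -- truncLogPath k b g ≥ x` at every level `k`. Letting `k` grow gives `objective g b ≤ -x < m`,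
  -- against minimality.
  · by_contra hcon
    rw [not_eventually] at hcon
    have hcon' : ∃ᶠ n in atTop, N ≤ n ∧ x ≤ V n :=
      (hcon.and_eventually (eventually_ge_atTop N)).mono fun n hn => ⟨hn.2, not_lt.mp hn.1⟩
    obtain ⟨φ, hφ, hP⟩ := extraction_of_frequently_atTop hcon'
    have hball : ∀ k, a (φ k) ∈ Metric.closedBall (0 : E d) R := fun k => by
      rw [mem_closedBall_zero_iff]
      exact (hN _ (hP k).1).1 _ (ha _ (hP k).1).1
    obtain ⟨b, -, ψ, hψ, hlim⟩ := (isCompact_closedBall (0 : E d) R).tendsto_subseq hball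
    have hφψ : Tendsto (fun j => φ (ψ j)) atTop atTop := hφ.tendsto_atTop.comp hψ.tendsto_atTop
    have hbK : b ∈ constraintSet g :=
      mem_constraintSet_of_tendsto hφψ (hf.comp hφψ) (fun j => (ha _ (hP (ψ j)).1).1) hlim
    have hint : ∀ k, x ≤ ∫ t, truncLogPath k b g t := by
      intro k
      refine ge_of_tendsto (tendsto_gridAvg_truncLogPath k hφψ (hf.comp hφψ) hlim)
        (Eventually.of_forall fun j => ?_)
      exact (hP (ψ j)).2.trans (hVle k _ (hP (ψ j)).1)
    have hle : objective g b ≤ ((-x : ℝ) : EReal) := by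
      rw [objective_eq_iSup]
      exact iSup_le fun k => EReal.coe_le_coe_iff.mpr (neg_le_neg (hint k))
    have := EReal.coe_le_coe_iff.mp ((hmin b hbK).trans hle)
    linarith

/-! ### Weak convergence -/

lemma measure_map_eq {Ω T : Type*} [MeasurableSpace Ω] [MeasurableSpace T] {P : Measure Ω}
    {X : Ω → T} (hX : AEMeasurable X P) {F : Set T} (hF : MeasurableSet F) :
    P.map X F = P {ω | X ω ∈ F} := Measure.map_apply_of_aemeasurable hX hF

/-- Sequential continuous convergence implies joint convergence along `atTop ×ˢ 𝓝 y₀`. -/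
lemma tendsto_prod_nhds_of_seq {S T : Type*} [TopologicalSpace S] [FirstCountableTopology S]
    [TopologicalSpace T] {Φ : ℕ → S → T} {y₀ : S} {z : T}
    (h : ∀ y : ℕ → S, Tendsto y atTop (𝓝 y₀) → Tendsto (fun n => Φ n (y n)) atTop (𝓝 z)) :
    Tendsto (fun p : ℕ × S => Φ p.1 p.2) (atTop ×ˢ 𝓝 y₀) (𝓝 z) := by
  intro U hU
  by_contra hcon
  obtain ⟨V, hV⟩ := (𝓝 y₀).exists_antitone_basis
  have hfreq : ∀ k : ℕ, ∃ᶠ n in atTop, ∃ y ∈ V k, Φ n y ∉ U := by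
    intro k
    rw [frequently_atTop]
    intro N
    by_contra! hk
    refine hcon (mem_map.mpr ?_)
    filter_upwards [prod_mem_prod (Ici_mem_atTop N) (hV.mem k)] with p hp
    exact hk p.1 hp.1 p.2 hp.2
  obtain ⟨φ, hφ, hP⟩ := extraction_forall_of_frequently hfreq
  choose y hyV hyU using hP
  -- The counterexamples along `φ` become a full sequence by inserting `y₀` at the other indices.
  have hy : Tendsto (Function.extend φ y fun _ => y₀) atTop (𝓝 y₀) := by
    rw [hV.tendsto_right_iff]
    intro K _
    filter_upwards [eventually_gt_atTop (φ K)] with n hn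
    by_cases hex : ∃ k, φ k = n
    · obtain ⟨k, rfl⟩ := hex
      rw [hφ.injective.extend_apply]
      exact hV.antitone (hφ.lt_iff_lt.mp hn).le (hyV k)
    · rw [Function.extend_apply' _ _ _ hex]
      exact mem_of_mem_nhds (hV.mem K)
  have hlim := (h _ hy).comp hφ.tendsto_atTop
  obtain ⟨k, hk⟩ := (hlim.eventually hU).exists
  simp only [Function.comp, hφ.injective.extend_apply] at hk
  exact hyU k hk

/-- The extended continuous mapping theorem. -/
theorem tendstoInDistribution_of_continuousConvergence {Ω Ω' S T : Type*} [MeasurableSpace Ω]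
    [MeasurableSpace Ω'] {P : Measure Ω} [IsProbabilityMeasure P] {P' : Measure Ω'}
    [IsProbabilityMeasure P'] [TopologicalSpace S] [FirstCountableTopology S] [MeasurableSpace S]
    [BorelSpace S] [HasOuterApproxClosed S] [TopologicalSpace T]
    [TopologicalSpace.PseudoMetrizableSpace T] [MeasurableSpace T] [BorelSpace T]
    {Y : ℕ → Ω → S} {Y₀ : Ω' → S} (hY : TendstoInDistribution Y atTop Y₀ (fun _ => P) P')
    {Φ : ℕ → S → T} (hΦ : ∀ n, Measurable (Φ n)) {Φ₀ : S → T}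
    (hlim : ∀ᵐ ω' ∂P', ∀ y : ℕ → S, Tendsto y atTop (𝓝 (Y₀ ω')) →
      Tendsto (fun n => Φ n (y n)) atTop (𝓝 (Φ₀ (Y₀ ω')))) :
    TendstoInDistribution (fun n ω => Φ n (Y n ω)) atTop (fun ω' => Φ₀ (Y₀ ω'))
      (fun _ => P) P' := by
  have hm : ∀ n, AEMeasurable (fun ω => Φ n (Y n ω)) P := fun n =>
    (hΦ n).comp_aemeasurable (hY.forall_aemeasurable n)
  have hm₀ : AEMeasurable (fun ω' => Φ₀ (Y₀ ω')) P' := by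
    -- No measurability of `Φ₀` is assumed; `Φ₀ ∘ Y₀` is an almost sure limit of the measurable `Φ n
    -- ∘ Y₀`.
    refine aemeasurable_of_tendsto_metrizable_ae atTop
      (fun n => (hΦ n).comp_aemeasurable hY.aemeasurable_limit) ?_
    filter_upwards [hlim] with ω' h
    exact h _ tendsto_const_nhds
  refine ⟨hm, hm₀, tendsto_of_forall_isClosed_limsup_le' fun F hF => ?_⟩
  -- Portmanteau applies to these closed sets for fixed `m`. A point `Y₀ ω'` in all of them is
  -- approached by points of `Φ n ⁻¹' F` with `n` arbitrarily large, so continuous convergence puts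
  -- `Φ₀ (Y₀ ω')` in `F`.
  set A : ℕ → Set S := fun m => closure (⋃ n ≥ m, Φ n ⁻¹' F) with hA
  have hAc : ∀ m, IsClosed (A m) := fun m => isClosed_closure
  have hAanti : Antitone A := fun m m' hmm' =>
    closure_mono (Set.biUnion_subset_biUnion_left fun n hn => le_trans hmm' hn)
  have hle : ∀ m, limsup (fun n => P.map (fun ω => Φ n (Y n ω)) F) atTop ≤ P'.map Y₀ (A m) := by
    intro m
    refine le_trans (limsup_le_limsup (v := fun n => P.map (Y n) (A m)) ?_)
      (ProbabilityMeasure.limsup_measure_closed_le_of_tendsto hY.tendsto (hAc m))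
    filter_upwards [eventually_ge_atTop m] with n hn
    rw [measure_map_eq (hm n) hF.measurableSet,
      measure_map_eq (hY.forall_aemeasurable n) (hAc m).measurableSet]
    refine measure_mono fun ω hω => subset_closure ?_
    exact Set.mem_biUnion (show n ≥ m from hn) hω
  have hprob : IsProbabilityMeasure (P'.map Y₀) :=
    Measure.isProbabilityMeasure_map hY.aemeasurable_limit
  have hinf : Tendsto (fun m => P'.map Y₀ (A m)) atTop (𝓝 (P'.map Y₀ (⋂ m, A m))) :=
    tendsto_measure_iInter_atTop (fun m => (hAc m).measurableSet.nullMeasurableSet) hAanti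
      ⟨0, measure_ne_top _ _⟩
  refine (ge_of_tendsto hinf (Eventually.of_forall hle)).trans ?_
  change P'.map Y₀ _ ≤ P'.map (fun ω' => Φ₀ (Y₀ ω')) F
  rw [measure_map_eq hm₀ hF.measurableSet, measure_map_eq hY.aemeasurable_limit
    (isClosed_iInter hAc).measurableSet]
  refine measure_mono_ae ?_
  filter_upwards [hlim] with ω' h hmem
  have htend := tendsto_prod_nhds_of_seq h
  refine hF.mem_of_frequently_of_tendsto ?_ htend
  intro hev
  obtain ⟨p1, hp1, p2, hp2, hpp⟩ := eventually_prod_iff.mp hev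
  obtain ⟨m, hm'⟩ := eventually_atTop.mp hp1
  have hmemm : Y₀ ω' ∈ A m := Set.mem_iInter.mp hmem m
  obtain ⟨y, hy, hyU⟩ := mem_closure_iff_nhds.mp hmemm _ hp2
  obtain ⟨n, hn, hyn⟩ := Set.mem_iUnion₂.mp hyU
  exact hpp (hm' n hn) hy hyn

/-- Convergence in distribution depends on the laws only. -/
lemma tendstoInDistribution_congr_law {Ω Ω' T : Type*} [MeasurableSpace Ω]
    [MeasurableSpace Ω'] {P : Measure Ω} [IsProbabilityMeasure P] {P' : Measure Ω'}
    [IsProbabilityMeasure P'] [TopologicalSpace T] [MeasurableSpace T] [OpensMeasurableSpace T]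
    {X X' : ℕ → Ω → T} {Z Z' : Ω' → T}
    (h : TendstoInDistribution X atTop Z (fun _ => P) P')
    (hX : ∀ᶠ n in atTop, P.map (X' n) = P.map (X n)) (hX' : ∀ n, AEMeasurable (X' n) P)
    (hZ' : AEMeasurable Z' P') (hZ : P'.map Z = P'.map Z') :
    TendstoInDistribution X' atTop Z' (fun _ => P) P' := by
  refine ⟨hX', hZ', ?_⟩
  have e : (⟨P'.map Z', Measure.isProbabilityMeasure_map hZ'⟩ : ProbabilityMeasure T) =
      ⟨P'.map Z, Measure.isProbabilityMeasure_map h.aemeasurable_limit⟩ := Subtype.ext hZ.symm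
  rw [e]
  refine h.tendsto.congr' ?_
  filter_upwards [hX] with n hn
  refine Subtype.ext ?_
  exact hn.symm

/-- Tightness along a decreasing sequence of closed sets. -/
lemma exists_eventually_measure_le {Ω Ω' T : Type*} [MeasurableSpace Ω]
    [MeasurableSpace Ω'] {P : Measure Ω} [IsProbabilityMeasure P] {P' : Measure Ω'}
    [IsProbabilityMeasure P'] [TopologicalSpace T] [MeasurableSpace T] [BorelSpace T]
    [HasOuterApproxClosed T] {X : ℕ → Ω → T} {Z : Ω' → T}
    (h : TendstoInDistribution X atTop Z (fun _ => P) P') {F : ℕ → Set T}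
    (hF : ∀ k, IsClosed (F k)) (hanti : Antitone F) (hnull : ∀ᵐ ω' ∂P', ∃ k, Z ω' ∉ F k)
    {ε : ℝ≥0∞} (hε : 0 < ε) : ∃ k, ∀ᶠ n in atTop, P {ω | X n ω ∈ F k} ≤ ε := by
  have hprob : IsProbabilityMeasure (P'.map Z) :=
    Measure.isProbabilityMeasure_map h.aemeasurable_limit
  have hinf : Tendsto (fun m => P'.map Z (F m)) atTop (𝓝 (P'.map Z (⋂ m, F m))) :=
    tendsto_measure_iInter_atTop (fun m => (hF m).measurableSet.nullMeasurableSet) hanti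
      ⟨0, measure_ne_top _ _⟩
  have hzero : P'.map Z (⋂ m, F m) = 0 := by
    rw [measure_map_eq h.aemeasurable_limit (isClosed_iInter hF).measurableSet]
    have : ∀ᵐ ω' ∂P', ¬ (Z ω' ∈ ⋂ m, F m) := by
      filter_upwards [hnull] with ω' ⟨k, hk⟩ hmem
      exact hk (Set.mem_iInter.mp hmem k)
    simpa using ae_iff.mp this
  rw [hzero] at hinf
  obtain ⟨k, hk⟩ := (hinf.eventually (gt_mem_nhds hε)).exists
  refine ⟨k, ?_⟩
  have hls := (ProbabilityMeasure.limsup_measure_closed_le_of_tendsto h.tendsto (hF k)).trans_lt hk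
  filter_upwards [eventually_lt_of_limsup_lt hls] with n hn
  rw [← measure_map_eq (h.forall_aemeasurable n) (hF k).measurableSet]
  exact hn.le

/-! ### Brownian paths -/

lemma gaussianReal_abs_ge_le {v : ℝ} (hv : 0 ≤ v) {c : ℝ} (hc : 0 < c) :
    gaussianReal 0 v.toNNReal {x | c ≤ |x|} ≤ ENNReal.ofReal (v / c ^ 2) := by
  have h := meas_ge_le_variance_div_sq (μ := gaussianReal 0 v.toNNReal) (X := id)
    (memLp_id_gaussianReal 2) hc
  rw [variance_id_gaussianReal, Real.coe_toNNReal _ hv] at h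
  simpa using h

/-- The lower bound is independent of `v`, which makes the Borel-Cantelli series diverge. -/
lemma gaussianReal_sign_mul_ge {v : ℝ} (hv : 0 ≤ v) {c ς : ℝ} (hς : ς * ς = 1)
    (hc : c ≤ √v * √2) :
    gaussianReal 0 1 (Set.Ici √2) ≤ gaussianReal 0 v.toNNReal {x | c ≤ ς * x} := by
  have hmap : (gaussianReal 0 1).map (fun x => (ς * √v) * x) = gaussianReal 0 v.toNNReal := by
    rw [gaussianReal_map_const_mul]
    congr 1
    · simp
    · ext
      simp only [NNReal.coe_mk, mul_one, Real.coe_toNNReal _ hv]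
      calc (ς * √v) ^ 2 = (ς * ς) * (√v ^ 2) := by ring
        _ = v := by rw [hς, Real.sq_sqrt hv, one_mul]
  have hmeas : MeasurableSet {x : ℝ | c ≤ ς * x} :=
    measurableSet_le measurable_const (by fun_prop)
  rw [← hmap, Measure.map_apply (by fun_prop) hmeas]
  refine measure_mono fun x hx => ?_
  change c ≤ ς * (ς * √v * x)
  have : ς * (ς * √v * x) = √v * x := by
    calc ς * (ς * √v * x) = (ς * ς) * (√v * x) := by ring
      _ = _ := by rw [hς, one_mul]
  rw [this]
  exact hc.trans (mul_le_mul_of_nonneg_left hx (Real.sqrt_nonneg v))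

lemma gaussianReal_Ici_pos (c : ℝ) : gaussianReal 0 1 (Set.Ici c) ≠ 0 := fun h => by
  have := gaussianReal_absolutelyContinuous' 0 one_ne_zero h
  simp at this

section Brownian

variable {Ω : Type*} [MeasurableSpace Ω] {d : ℕ} {B : Ω → Paths d} {P : Measure Ω}

lemma IsBrownian.measurable_eval (hB : IsBrownian B P) (t : I) (i : Fin d) :
    Measurable fun ω => B ω t i := by
  have h : Continuous fun b : Paths d => b t i := by fun_prop
  exact h.measurable.comp hB.measurable

/-- Only finitely many increments matter at a time; on indices below `N`, the reversal `k ↦ N - k`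
produces increasing times. -/
lemma IsBrownian.iIndepFun_decreasing (hB : IsBrownian B P) {t : ℕ → I} (ht : Antitone t)
    (i : Fin d) : iIndepFun (fun (k : ℕ) ω => B ω (t k) i - B ω (t (k + 1)) i) P := by
  rw [iIndepFun_iff_finset]
  intro s
  obtain ⟨N, hN⟩ := s.exists_nat_subset_range
  have hlt : ∀ x : s, (x : ℕ) < N := fun x => Finset.mem_range.mp (hN x.2)
  have hmono : Monotone fun j : ℕ => t (N - j) := fun j l hjl => ht (by omega)
  have h := (hB.indepIncrements i).nat hmono
  have hinj : Function.Injective fun x : s => N - 1 - (x : ℕ) := by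
    intro x y hxy
    have := hlt x
    have := hlt y
    dsimp only at hxy
    exact Subtype.ext (by omega)
  have h' := h.precomp hinj
  refine (iIndepFun_congr fun x => Eventually.of_forall fun ω => ?_).mp h'
  have := hlt x
  have e1 : N - (N - 1 - (x : ℕ) + 1) = x := by omega
  have e2 : N - (N - 1 - (x : ℕ)) = x + 1 := by omega
  simp only [e1, e2, Finset.restrict]

/-- Independence across coordinates and independence in time within each coordinate combine into
joint independence. -/
lemma IsBrownian.iIndepFun_increments (hB : IsBrownian B P) {s t : ℕ → I}
    (h : ∀ i : Fin d, iIndepFun (fun (k : ℕ) ω => B ω (t k) i - B ω (s k) i) P) :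
    iIndepFun (fun (p : Fin d × ℕ) ω => B ω (t p.2) p.1 - B ω (s p.2) p.1) P := by
  refine iIndepFun_uncurry' (X := fun i k ω => B ω (t k) i - B ω (s k) i)
    (fun i k => (hB.measurable_eval _ i).sub (hB.measurable_eval _ i)) ?_ h
  exact hB.indepCoordinates.comp (fun _ (x : I → ℝ) (k : ℕ) => x (t k) - x (s k))
    fun i => by fun_prop

lemma IsBrownian.map_eval (hB : IsBrownian B P) (t : I) (i : Fin d) :
    P.map (fun ω => B ω t i) = gaussianReal 0 (t : ℝ).toNNReal := by
  have h := hB.gaussianIncrements i 0 t t.2.1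
  rw [Set.Icc.coe_zero, sub_zero] at h
  rw [← h]
  refine Measure.map_congr ?_
  filter_upwards [hB.zero] with ω hω
  simp [hω]

/-- Borel-Cantelli along super-geometrically decreasing times: almost surely, the path visits the
open orthant with signs `ς` at infinitely many of these times, with a margin. -/
lemma IsBrownian.frequently_orthant [IsProbabilityMeasure P] (hB : IsBrownian B P)
    {ς : Fin d → ℝ} (hς : ∀ i, ς i * ς i = 1) {t : ℕ → I}
    (hpos : ∀ k, 0 < (t k : ℝ)) (hdec : ∀ k, (t (k + 1) : ℝ) ≤ t k * (1 / 2) ^ (k + 1)) :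
    ∀ᵐ ω ∂P, ∃ᶠ k in atTop, ∀ i, √(t k) / 2 ≤ ς i * B ω (t k) i := by
  have hhalf : ∀ k, (t (k + 1) : ℝ) ≤ t k / 2 := by
    intro k
    refine (hdec k).trans ?_
    have : ((1 : ℝ) / 2) ^ (k + 1) ≤ 1 / 2 := by
      rw [pow_succ]
      exact mul_le_of_le_one_left (by norm_num) (pow_le_one₀ (by norm_num) (by norm_num))
    nlinarith [hpos k]
  have hanti : Antitone t := antitone_nat_of_succ_le fun k => by
    have := hhalf k
    have := hpos k
    exact Subtype.coe_le_coe.mp (by linarith)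
  -- large increments occur infinitely often
  set A : ℕ → Fin d → Set ℝ := fun k i => {x | √(t k) ≤ ς i * x} with hA
  have hAm : ∀ k i, MeasurableSet (A k i) := fun k i =>
    measurableSet_le measurable_const (by fun_prop)
  set X : Fin d × ℕ → Ω → ℝ := fun p ω => B ω (t p.2) p.1 - B ω (t (p.2 + 1)) p.1 with hX
  have hXm : ∀ p, Measurable (X p) := fun p =>
    (hB.measurable_eval _ _).sub (hB.measurable_eval _ _)
  have hXind : iIndepFun X P :=
    hB.iIndepFun_increments (s := fun k => t (k + 1)) fun i => hB.iIndepFun_decreasing hanti i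
  set En : ℕ → Set Ω := fun k => ⋂ i : Fin d, X (i, k) ⁻¹' A k i with hE
  have hEm : ∀ k, MeasurableSet (En k) := fun k => MeasurableSet.iInter fun i => hXm _ (hAm k i)
  have hprod : ∀ s : Finset ℕ, P (⋂ k ∈ s, En k) =
      ∏ k ∈ s, ∏ i : Fin d, P (X (i, k) ⁻¹' A k i) := by
    intro s
    have h := hXind.measure_inter_preimage_eq_mul ((Finset.univ : Finset (Fin d)) ×ˢ s)
      (sets := fun p => A p.2 p.1) fun p _ => hAm _ _
    rw [Finset.prod_product_right] at h
    rw [← h]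
    congr 1
    ext ω
    simp only [hE, Set.mem_iInter, Finset.mem_product, Finset.mem_univ, true_and]
    exact ⟨fun h p hp => h p.2 hp p.1, fun h k hk i => h (i, k) hk⟩
  have hsingle : ∀ k, P (En k) = ∏ i : Fin d, P (X (i, k) ⁻¹' A k i) := by
    intro k
    have := hprod {k}
    simpa using this
  have hindep : iIndepSet En P := by
    rw [iIndepSet_iff_meas_biInter hEm]
    intro s
    rw [hprod, Finset.prod_congr rfl fun k _ => (hsingle k).symm]
  set q : ℝ≥0∞ := gaussianReal 0 1 (Set.Ici √2) with hq
  have hlow : ∀ k, q ^ d ≤ P (En k) := by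
    intro k
    rw [hsingle]
    have : q ^ d = ∏ _i : Fin d, q := by simp
    rw [this]
    refine Finset.prod_le_prod' fun i _ => ?_
    have hle : t (k + 1) ≤ t k := hanti (Nat.le_succ k)
    have hv := hhalf k
    rw [← Measure.map_apply (hXm _) (hAm k i), hX]
    dsimp only
    rw [hB.gaussianIncrements i _ _ hle]
    refine gaussianReal_sign_mul_ge (by linarith [hpos k]) (hς i) ?_
    -- The increment has variance at least `t k / 2`, which is where the threshold `√2` comes from.
    rw [← Real.sqrt_mul (by linarith [hpos k])]
    exact Real.sqrt_le_sqrt (by linarith)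
  have hsum : ∑' k, P (En k) = ∞ := by
    refine top_unique ?_
    rw [← ENNReal.tsum_const_eq_top_of_ne_zero (α := ℕ) (pow_ne_zero d (gaussianReal_Ici_pos √2))]
    exact ENNReal.tsum_le_tsum hlow
  have hio : ∀ᵐ ω ∂P, ∃ᶠ k in atTop, ω ∈ En k := by
    have h1 := measure_limsup_eq_one hEm hindep hsum
    have h2 := (mem_ae_iff_prob_eq_one (MeasurableSet.measurableSet_limsup hEm)).mpr h1
    filter_upwards [h2] with ω hω
    exact mem_limsup_iff_frequently_mem.mp hω
  -- the later positions are eventually negligible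
  have hsmall : ∀ i : Fin d, ∀ᵐ ω ∂P, ∀ᶠ k in atTop,
      ω ∉ {ω | √(t k) / 2 ≤ |B ω (t (k + 1)) i|} := by
    intro i
    refine ae_eventually_notMem (ne_top_of_le_ne_top ?_ (ENNReal.tsum_le_tsum
      (g := fun k : ℕ => ENNReal.ofReal (4 * (1 / 2) ^ (k + 1))) fun k => ?_))
    · have hs : Summable fun k : ℕ => 4 * ((1 : ℝ) / 2) ^ (k + 1) :=
        ((summable_nat_add_iff 1).mpr
          (summable_geometric_of_lt_one (by norm_num) (by norm_num))).mul_left 4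
      rw [← ENNReal.ofReal_tsum_of_nonneg (fun k => by positivity) hs]
      exact ENNReal.ofReal_ne_top
    · have hsq : 0 < √(t k : ℝ) / 2 := by
        have := Real.sqrt_pos.mpr (hpos k)
        positivity
      have hm : MeasurableSet {x : ℝ | √(t k : ℝ) / 2 ≤ |x|} :=
        measurableSet_le measurable_const (by fun_prop)
      -- Chebyshev gives `4 t (k + 1) / t k`, which is summable by the super-geometric decay.
      have h := gaussianReal_abs_ge_le (hpos (k + 1)).le hsq
      rw [← hB.map_eval (t (k + 1)) i, Measure.map_apply (hB.measurable_eval _ _) hm] at h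
      refine h.trans (ENNReal.ofReal_le_ofReal ?_)
      rw [div_pow, Real.sq_sqrt (hpos k).le, div_le_iff₀ (by have := hpos k; positivity)]
      linarith [hdec k]
  filter_upwards [hio, ae_all_iff.mpr hsmall] with ω h1 h2
  refine (h1.and_eventually (eventually_all.mpr h2)).mono fun k hk i => ?_
  have e1 : √(t k : ℝ) ≤ ς i * (B ω (t k) i - B ω (t (k + 1)) i) := Set.mem_iInter.mp hk.1 i
  have e2 : |B ω (t (k + 1)) i| < √(t k : ℝ) / 2 := not_le.mp (hk.2 i)
  have e3 : |ς i * B ω (t (k + 1)) i| = |B ω (t (k + 1)) i| := by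
    have : |ς i| = 1 := by
      have := congrArg Real.sqrt (hς i)
      rwa [Real.sqrt_mul_self_eq_abs, Real.sqrt_one] at this
    rw [abs_mul, this, one_mul]
  have e4 := (abs_lt.mp (e3.trans_lt e2)).1
  linarith

/-- Almost surely, a Brownian path with linear drift leaves every closed half-space before `δ`. -/
lemma IsBrownian.exists_inner_neg [IsProbabilityMeasure P] (hB : IsBrownian B P) (c : E d) {δ : ℝ}
    (hδ : δ ∈ Set.Ioc (0 : ℝ) 1) :
    ∀ᵐ ω ∂P, ∀ a : E d, a ≠ 0 →
      ∃ t : I, (t : ℝ) ∈ Set.Ioo 0 δ ∧ inner ℝ a (B ω t + (t : ℝ) • c) < 0 := by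
  -- Consecutive ratios are `2 ^ (-(2k + 1))`, small enough for `IsBrownian.frequently_orthant`.
  set τ : ℕ → ℝ := fun k => δ / 2 * (1 / 2) ^ (k ^ 2) with hτ
  have hδ0 := hδ.1
  have hτpos : ∀ k, 0 < τ k := fun k => by positivity
  have hτlt : ∀ k, τ k < δ := fun k => by
    have : ((1 : ℝ) / 2) ^ (k ^ 2) ≤ 1 := pow_le_one₀ (by norm_num) (by norm_num)
    calc τ k ≤ δ / 2 * 1 := by rw [hτ]; dsimp only; gcongr
      _ < δ := by linarith
  set t : ℕ → I := fun k => ⟨τ k, (hτpos k).le, (hτlt k).le.trans hδ.2⟩ with ht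
  have hdec : ∀ k, (t (k + 1) : ℝ) ≤ t k * (1 / 2) ^ (k + 1) := by
    intro k
    change δ / 2 * (1 / 2) ^ ((k + 1) ^ 2) ≤ δ / 2 * (1 / 2) ^ (k ^ 2) * (1 / 2) ^ (k + 1)
    rw [mul_assoc, ← pow_add]
    refine mul_le_mul_of_nonneg_left ?_ (by positivity)
    exact pow_le_pow_of_le_one (by norm_num) (by norm_num) (by nlinarith)
  have hτ0 : Tendsto τ atTop (𝓝 0) := by
    have h1 : Tendsto (fun k : ℕ => ((1 : ℝ) / 2) ^ (k ^ 2)) atTop (𝓝 0) :=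
      (tendsto_pow_atTop_nhds_zero_of_lt_one (by norm_num) (by norm_num)).comp
        (tendsto_pow_atTop two_ne_zero)
    have h2 := h1.const_mul (δ / 2)
    rwa [mul_zero] at h2
  set sgn : (Fin d → Bool) → Fin d → ℝ := fun b i => if b i then 1 else -1 with hsgn
  have hsq : ∀ b i, sgn b i * sgn b i = 1 := fun b i => by
    rw [hsgn]; dsimp only; split_ifs <;> norm_num
  -- There are finitely many sign patterns, so one null set serves all `a`.
  have hall : ∀ᵐ ω ∂P, ∀ b : Fin d → Bool, ∃ᶠ k in atTop, ∀ i,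
      √(t k : ℝ) / 2 ≤ sgn b i * B ω (t k) i :=
    ae_all_iff.mpr fun b => hB.frequently_orthant (hsq b) (fun k => hτpos k) hdec
  filter_upwards [hall] with ω hω a ha
  -- In the orthant with signs opposite to those of `a`, every term of the inner product is
  -- nonpositive, and strictly negative where `a i ≠ 0`.
  set b : Fin d → Bool := fun i => decide (a i ≤ 0) with hb
  have hdrift : ∀ᶠ k in atTop, √(τ k) * ‖c‖ < 1 / 2 := by
    have h1 : Tendsto (fun k => √(τ k) * ‖c‖) atTop (𝓝 (√0 * ‖c‖)) :=
      ((Real.continuous_sqrt.tendsto 0).comp hτ0).mul_const _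
    rw [Real.sqrt_zero, zero_mul] at h1
    exact h1.eventually (gt_mem_nhds (by norm_num))
  obtain ⟨k, hk1, hk2⟩ := ((hω b).and_eventually hdrift).exists
  refine ⟨t k, ⟨hτpos k, hτlt k⟩, ?_⟩
  have hsqrt : 0 < √(τ k) := Real.sqrt_pos.mpr (hτpos k)
  have hposi : ∀ i, 0 < sgn b i * (B ω (t k) + (t k : ℝ) • c) i := by
    intro i
    have e1 := hk1 i
    have e2 : |sgn b i * (τ k * c i)| ≤ τ k * ‖c‖ := by
      have : |sgn b i| = 1 := by
        rw [hsgn]; dsimp only; split_ifs <;> simp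
      rw [abs_mul, this, one_mul, abs_mul, abs_of_pos (hτpos k)]
      exact mul_le_mul_of_nonneg_left (PiLp.norm_apply_le c i) (hτpos k).le
    have e3 : τ k * ‖c‖ < √(τ k) / 2 := by
      calc τ k * ‖c‖ = √(τ k) * (√(τ k) * ‖c‖) := by
            rw [← mul_assoc, Real.mul_self_sqrt (hτpos k).le]
        _ < √(τ k) * (1 / 2) := by gcongr
        _ = _ := by ring
    have e4 := (abs_le.mp e2).1
    have e5 : sgn b i * (B ω (t k) + (t k : ℝ) • c) i =
        sgn b i * B ω (t k) i + sgn b i * (τ k * c i) := by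
      simp [ht, mul_add]
    rw [e5]
    change √(τ k) / 2 ≤ _ at e1
    linarith
  obtain ⟨j, hj⟩ : ∃ j, a j ≠ 0 := by
    by_contra! h
    exact ha (by ext i; simpa using h i)
  have hinner : inner ℝ a (B ω (t k) + (t k : ℝ) • c) =
      ∑ i, a i * (B ω (t k) + (t k : ℝ) • c) i := by
    rw [PiLp.inner_apply]
    refine Finset.sum_congr rfl fun i _ => ?_
    simp [mul_comm]
  have hterm : ∀ i, a i * (B ω (t k) + (t k : ℝ) • c) i ≤ 0 ∧
      (a i ≠ 0 → a i * (B ω (t k) + (t k : ℝ) • c) i < 0) := by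
    intro i
    have h := hposi i
    by_cases hai : a i ≤ 0
    · have hs : sgn b i = 1 := by simp [hsgn, hb, hai]
      rw [hs, one_mul] at h
      exact ⟨mul_nonpos_of_nonpos_of_nonneg hai h.le,
        fun h0 => mul_neg_of_neg_of_pos (lt_of_le_of_ne hai h0) h⟩
    · have hs : sgn b i = -1 := by simp [hsgn, hb, hai]
      rw [hs] at h
      have h' : (B ω (t k) + (t k : ℝ) • c) i < 0 := by linarith
      have := mul_neg_of_pos_of_neg (not_le.mp hai) h'
      exact ⟨this.le, fun _ => this⟩
  rw [hinner]
  exact Finset.sum_neg' (fun i _ => (hterm i).1) ⟨j, Finset.mem_univ _, (hterm j).2 hj⟩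

/-- Grid values of a Brownian path have a symmetric law. -/
lemma IsBrownian.map_neg_grid [IsProbabilityMeasure P] (hB : IsBrownian B P) {t : ℕ → I}
    (ht : Monotone t) (ht0 : t 0 = 0) :
    P.map (fun ω (k : ℕ) => -B ω (t k)) = P.map (fun ω (k : ℕ) => B ω (t k)) := by
  set X : Fin d × ℕ → Ω → ℝ := fun p ω => B ω (t (p.2 + 1)) p.1 - B ω (t p.2) p.1 with hX
  have hXm : ∀ p, Measurable (X p) := fun p =>
    (hB.measurable_eval _ _).sub (hB.measurable_eval _ _)
  have hXind : iIndepFun X P :=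
    hB.iIndepFun_increments (t := fun k => t (k + 1)) fun i => (hB.indepIncrements i).nat ht
  have hid : ∀ p, IdentDistrib (fun ω => -X p ω) (X p) P P := by
    intro p
    refine ⟨(hXm p).neg.aemeasurable, (hXm p).aemeasurable, ?_⟩
    have hg := hB.gaussianIncrements p.1 (t p.2) (t (p.2 + 1)) (ht (Nat.le_succ _))
    have : P.map (fun ω => -X p ω) = (P.map (X p)).map fun x => -x :=
      (Measure.map_map measurable_neg (hXm p)).symm
    rw [this]
    change (P.map fun ω => _).map _ = P.map fun ω => _
    rw [hg, gaussianReal_map_neg, neg_zero]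
  have hpi := IdentDistrib.pi hid (hXind.comp (fun _ x => -x) fun _ => measurable_neg) hXind
  -- Grid values are partial sums of independent increments, each with a symmetric law.
  set L : (Fin d × ℕ → ℝ) → ℕ → E d := fun x k =>
    WithLp.toLp 2 fun i => ∑ j ∈ Finset.range k, x (i, j) with hL
  have hLm : Measurable L := by
    refine measurable_pi_lambda _ fun k => ?_
    refine (WithLp.measurable_toLp 2 _).comp (measurable_pi_lambda _ fun i => ?_)
    exact Finset.measurable_sum _ fun j _ => measurable_pi_apply _
  have htel : ∀ᵐ ω ∂P, L (fun p => X p ω) = fun k => B ω (t k) := by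
    filter_upwards [hB.zero] with ω hω
    ext k i
    change ∑ j ∈ Finset.range k, (B ω (t (j + 1)) i - B ω (t j) i) = _
    rw [Finset.sum_range_sub (fun j => B ω (t j) i), ht0, hω]
    simp
  have htel' : ∀ᵐ ω ∂P, L (fun p => -X p ω) = fun k => -B ω (t k) := by
    filter_upwards [htel] with ω hω
    ext k i
    have h1 := congrArg (fun v : ℕ → E d => v k i) hω
    simp only [hL] at h1 ⊢
    simp [h1]
  rw [← Measure.map_congr htel, ← Measure.map_congr htel']
  exact (hpi.comp hLm).map_eq

end Brownian

/-! ### Weighted paths with drift -/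

/-- The weight function as a continuous function on the unit interval. -/
noncomputable def weightPath (w : ℝ → ℝ) (hw : ContinuousOn w (Set.Icc 0 1)) : C(I, ℝ) where
  toFun t := w t
  continuous_toFun := hw.domRestrict

/-- The path `t ↦ v(t) [y(t) + t c]`. -/
noncomputable def driftPath {d : ℕ} (v : C(I, ℝ)) (c : E d) (y : Paths d) : Paths d where
  toFun t := v t • (y t + (t : ℝ) • c)
  continuous_toFun := by fun_prop

lemma continuous_driftPath {d : ℕ} (v : C(I, ℝ)) (c : E d) : Continuous (driftPath v c) := by
  refine ContinuousMap.continuous_of_continuous_uncurry _ ?_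
  change Continuous fun r : Paths d × I => v r.2 • (r.1 r.2 + (r.2 : ℝ) • c)
  fun_prop

lemma measurable_seqNegLog_gridValues {d : ℕ} (v : C(I, ℝ)) (c : E d) (n : ℕ) :
    Measurable fun y : Paths d => seqNegLog n (gridValues n (driftPath v c y)) := by
  refine (measurable_seqNegLog n).comp (measurable_pi_lambda _ fun i => ?_)
  have h : Continuous fun y : Paths d => y (gridPoint n i) := by fun_prop
  exact (h.comp (continuous_driftPath v c)).measurable

lemma partialSumPath_gridPoint {d : ℕ} (x : ℤ → E d) (μ : E d) {n i : ℕ}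
    (hi : i ∈ Finset.Icc 1 n) :
    partialSumPath x μ n (gridPoint n i) = ∑ j ∈ Finset.Icc 1 i, (x j - μ) := by
  have hi' := Finset.mem_Icc.mp hi
  have hn : (n : ℝ) ≠ 0 := by
    have : 0 < n := by omega
    positivity
  change ∑ j ∈ Finset.Icc 1 n,
    (max 0 (min 1 ((n : ℝ) * (gridPoint n i : ℝ) - ((j : ℝ) - 1)))) • (x j - μ) = _
  rw [coe_gridPoint hi, mul_div_cancel₀ _ hn]
  symm
  refine Finset.sum_subset_zero_on_sdiff (Finset.Icc_subset_Icc_right hi'.2) (fun j hj => ?_)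
    fun j hj => ?_
  · rw [Finset.mem_sdiff, Finset.mem_Icc, Finset.mem_Icc] at hj
    have : (i : ℝ) + 1 ≤ j := by exact_mod_cast (by omega : i + 1 ≤ j)
    rw [max_eq_left ((min_le_right _ _).trans (by linarith)), zero_smul]
  · have : (j : ℝ) ≤ i := by exact_mod_cast (Finset.mem_Icc.mp hj).2
    rw [min_eq_left (by linarith), max_eq_right zero_le_one, one_smul]

/-- After rescaling by `r = n ^ (-1/2)`, the shift `r • c` summed over `i` terms contributes `i r² c
= (i / n) c`, hence the drift `-c`. -/
lemma negLogRatio_eq_gridValues {d : ℕ} {w : ℝ → ℝ} (hw : ContinuousOn w (Set.Icc 0 1))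
    (x : ℤ → E d) (μ c : E d) {n : ℕ} (hn : 1 ≤ n) :
    negLogRatio w x n (μ + (n : ℝ) ^ (-(1 / 2) : ℝ) • c) =
      seqNegLog n (gridValues n (driftPath (weightPath w hw) (-c)
        ((n : ℝ) ^ (-(1 / 2) : ℝ) • partialSumPath x μ n))) := by
  have hn0 : (0 : ℝ) < n := by exact_mod_cast hn
  set r : ℝ := (n : ℝ) ^ (-(1 / 2) : ℝ) with hr
  have hr0 : 0 < r := Real.rpow_pos_of_pos hn0 _
  have hrr : r * r = (n : ℝ)⁻¹ := by
    rw [hr, ← Real.rpow_add hn0, ← Real.rpow_neg_one]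
    norm_num
  rw [negLogRatio_eq_seqNegLog, seqNegLog, seqNegLog, ← seqLikelihood_smul hr0.ne']
  congr 5
  refine seqLikelihood_congr fun i hi => ?_
  change r • w ((i : ℝ) / n) • ∑ j ∈ Finset.Icc 1 i, (x j - (μ + r • c)) =
    w (gridPoint n i : ℝ) • (r • partialSumPath x μ n (gridPoint n i) +
      (gridPoint n i : ℝ) • (-c))
  rw [partialSumPath_gridPoint x μ hi, coe_gridPoint hi, smul_comm r]
  congr 1
  simp only [← sub_sub]
  rw [Finset.sum_sub_distrib, Finset.sum_const, Nat.card_Icc, add_tsub_cancel_right, smul_sub,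
    smul_neg, ← sub_eq_add_neg, ← Nat.cast_smul_eq_nsmul ℝ, smul_smul, smul_smul]
  congr 2
  rw [div_eq_mul_inv, ← hrr]
  ring

/-! ### Invariance under linear maps -/

lemma Spans.of_inner_eq {d : ℕ} {f f' : I → E d} {u : E d → E d} (hf : Spans f)
    (hu : ∀ a, a ≠ 0 → u a ≠ 0) (h : ∀ a t, inner ℝ a (f' t) = inner ℝ (u a) (f t)) :
    Spans f' := by
  intro a ha
  obtain ⟨t, ht⟩ := hf (u a) (hu a ha)
  exact ⟨t, by rwa [h]⟩

/-- The dual problem sees the path only through inner products with `a`, so a surjective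
substitution in `a` leaves the infimum unchanged. It is applied to `S^{1/2}` and to negation. -/
lemma minObjective_eq_of_inner_eq {d : ℕ} {f f' : I → E d} {u : E d → E d}
    (hu : Function.Surjective u) (h : ∀ a t, inner ℝ a (f' t) = inner ℝ (u a) (f t)) :
    minObjective f' = minObjective f := by
  have h1 : ∀ a, objective f' a = objective f (u a) := fun a => by
    simp only [objective, h]
  have h2 : ∀ a, a ∈ constraintSet f' ↔ u a ∈ constraintSet f := fun a =>
    forall_congr' fun t => by rw [h]
  unfold minObjective
  congr 1
  ext z
  constructor
  · rintro ⟨a, ha, rfl⟩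
    exact ⟨u a, (h2 a).mp ha, (h1 a).symm⟩
  · rintro ⟨b, hb, rfl⟩
    obtain ⟨a, rfl⟩ := hu b
    exact ⟨a, (h2 a).mpr hb, h1 a⟩

section matrixSqrt

open scoped MatrixOrder

variable {d : ℕ} {S : Matrix (Fin d) (Fin d) ℝ}

lemma isUnit_det_matrixSqrt (hS : S.PosDef) : IsUnit (matrixSqrt S).det := by
  have h0 : 0 ≤ S := hS.posSemidef.nonneg
  rw [← Matrix.isUnit_iff_isUnit_det, matrixSqrt, CFC.isUnit_sqrt_iff S h0]
  exact hS.isUnit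

lemma inner_toEuclideanCLM_matrixSqrt (a x : E d) :
    inner ℝ a (Matrix.toEuclideanCLM (𝕜 := ℝ) (matrixSqrt S) x) =
      inner ℝ (Matrix.toEuclideanCLM (𝕜 := ℝ) (matrixSqrt S) a) x := by
  have h0 : 0 ≤ matrixSqrt S := CFC.sqrt_nonneg S
  have h1 : IsSelfAdjoint (matrixSqrt S) := (Matrix.nonneg_iff_posSemidef.mp h0).isHermitian
  have h2 : IsSelfAdjoint (Matrix.toEuclideanCLM (𝕜 := ℝ) (matrixSqrt S)) :=
    h1.map (Matrix.toEuclideanCLM (n := Fin d) (𝕜 := ℝ))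
  rw [← ContinuousLinearMap.adjoint_inner_right, h2.adjoint_eq]

lemma toEuclideanCLM_mul_inv (hS : S.PosDef) (x : E d) :
    Matrix.toEuclideanCLM (𝕜 := ℝ) (matrixSqrt S)
      (Matrix.toEuclideanCLM (𝕜 := ℝ) (matrixSqrt S)⁻¹ x) = x := by
  have h := map_mul (Matrix.toEuclideanCLM (n := Fin d) (𝕜 := ℝ)) (matrixSqrt S) (matrixSqrt S)⁻¹
  rw [Matrix.mul_nonsing_inv _ (isUnit_det_matrixSqrt hS), map_one] at h
  exact (DFunLike.congr_fun h x).symm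

lemma toEuclideanCLM_inv_mul (hS : S.PosDef) (x : E d) :
    Matrix.toEuclideanCLM (𝕜 := ℝ) (matrixSqrt S)⁻¹
      (Matrix.toEuclideanCLM (𝕜 := ℝ) (matrixSqrt S) x) = x := by
  have h := map_mul (Matrix.toEuclideanCLM (n := Fin d) (𝕜 := ℝ)) (matrixSqrt S)⁻¹ (matrixSqrt S)
  rw [Matrix.nonsing_inv_mul _ (isUnit_det_matrixSqrt hS), map_one] at h
  exact (DFunLike.congr_fun h x).symm

lemma driftPath_matrixPath {w : ℝ → ℝ} (hw : ContinuousOn w (Set.Icc 0 1)) (hS : S.PosDef)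
    (c : E d) (b : Paths d) (t : I) :
    driftPath (weightPath w hw) c (matrixPath (matrixSqrt S) b) t =
      Matrix.toEuclideanCLM (𝕜 := ℝ) (matrixSqrt S) (drifted w S c b t) := by
  change w t • (Matrix.toEuclideanCLM (𝕜 := ℝ) (matrixSqrt S) (b t) + (t : ℝ) • c) = _
  rw [drifted, map_smul, map_add, map_smul, toEuclideanCLM_mul_inv hS]

lemma inner_driftPath_matrixPath {w : ℝ → ℝ} (hw : ContinuousOn w (Set.Icc 0 1)) (hS : S.PosDef)
    (c : E d) (b : Paths d) (a : E d) (t : I) :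
    inner ℝ a (driftPath (weightPath w hw) c (matrixPath (matrixSqrt S) b) t) =
      inner ℝ (Matrix.toEuclideanCLM (𝕜 := ℝ) (matrixSqrt S) a) (drifted w S c b t) := by
  rw [driftPath_matrixPath hw hS, inner_toEuclideanCLM_matrixSqrt]

lemma minObjective_driftPath_matrixPath {w : ℝ → ℝ} (hw : ContinuousOn w (Set.Icc 0 1))
    (hS : S.PosDef) (c : E d) (b : Paths d) :
    minObjective (driftPath (weightPath w hw) c (matrixPath (matrixSqrt S) b)) =
      minObjective (drifted w S c b) :=
  minObjective_eq_of_inner_eq (fun x => ⟨_, toEuclideanCLM_mul_inv hS x⟩)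
    (inner_driftPath_matrixPath hw hS c b)

lemma spans_driftPath_matrixPath {w : ℝ → ℝ} (hw : ContinuousOn w (Set.Icc 0 1))
    (hS : S.PosDef) {c : E d} {b : Paths d} (h : Spans (drifted w S c b)) :
    Spans (driftPath (weightPath w hw) c (matrixPath (matrixSqrt S) b)) :=
  h.of_inner_eq (fun a ha h0 => ha (by rw [← toEuclideanCLM_inv_mul hS a, h0, map_zero]))
    (inner_driftPath_matrixPath hw hS c b)

lemma drifted_eq_driftPath {w : ℝ → ℝ} (hw : ContinuousOn w (Set.Icc 0 1)) (c : E d)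
    (b : Paths d) : drifted w S c b = driftPath (weightPath w hw)
      (Matrix.toEuclideanCLM (𝕜 := ℝ) (matrixSqrt S)⁻¹ c) b := rfl

lemma inner_driftPath_neg (v : C(I, ℝ)) (c : E d) (b : Paths d) (a : E d) (t : I) :
    inner ℝ a (driftPath v c (-b) t) = inner ℝ (-a) (driftPath v (-c) b t) := by
  have : driftPath v c (-b) t = -driftPath v (-c) b t := by
    change v t • (-b t + (t : ℝ) • c) = -(v t • (b t + (t : ℝ) • (-c)))
    rw [← smul_neg, smul_neg (t : ℝ)]
    congr 1
    abel
  rw [this, inner_neg_left, inner_neg_right]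

lemma drifted_neg (w : ℝ → ℝ) {hw : ContinuousOn w (Set.Icc 0 1)} (c : E d) (b : Paths d) :
    drifted w S (-c) b = driftPath (weightPath w hw)
      (-Matrix.toEuclideanCLM (𝕜 := ℝ) (matrixSqrt S)⁻¹ c) b := by
  rw [drifted_eq_driftPath hw, map_neg]

end matrixSqrt

/-- Multiplication by a positive weight keeps signs, so positivity of `w` near `0` is enough. -/
lemma IsBrownian.ae_spans_drifted {Ω : Type*} [MeasurableSpace Ω] {d : ℕ} {B : Ω → Paths d}
    {P : Measure Ω} [IsProbabilityMeasure P] (hB : IsBrownian B P) {w : ℝ → ℝ} (hw : IsWeight w)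
    (S : Matrix (Fin d) (Fin d) ℝ) (c : E d) : ∀ᵐ ω ∂P, Spans (drifted w S c (B ω)) := by
  obtain ⟨δ, hδ, hpos⟩ := hw.pos
  filter_upwards [hB.exists_inner_neg (Matrix.toEuclideanCLM (𝕜 := ℝ) (matrixSqrt S)⁻¹ c) hδ]
    with ω h a ha
  obtain ⟨t, ht, hlt⟩ := h a ha
  refine ⟨t, ?_⟩
  rw [drifted, inner_smul_right]
  exact mul_neg_of_pos_of_neg (hpos t ht) hlt

/-! ### Convergence in distribution of the log likelihood ratio -/

section Limit

variable {Ω' : Type*} [MeasurableSpace Ω'] {P' : Measure Ω'} [IsProbabilityMeasure P'] {d : ℕ}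
  {w : ℝ → ℝ} {S : Matrix (Fin d) (Fin d) ℝ} {B : Ω' → Paths d}

/-- Continuous mapping for the log likelihood ratio of a path process with drift. -/
lemma tendstoInDistribution_seqNegLog {Ω : Type*} [MeasurableSpace Ω] {P : Measure Ω}
    [IsProbabilityMeasure P] {Y : ℕ → Ω → Paths d} {Y₀ : Ω' → Paths d}
    (hY : TendstoInDistribution Y atTop Y₀ (fun _ => P) P') (v : C(I, ℝ)) (c : E d)
    (hs : ∀ᵐ ω' ∂P', Spans (driftPath v c (Y₀ ω'))) :
    TendstoInDistribution (fun n ω => seqNegLog n (gridValues n (driftPath v c (Y n ω)))) atTop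
      (fun ω' => -minObjective (driftPath v c (Y₀ ω'))) (fun _ => P) P' := by
  refine tendstoInDistribution_of_continuousConvergence hY
    (Φ := fun n y => seqNegLog n (gridValues n (driftPath v c y)))
    (Φ₀ := fun y => -minObjective (driftPath v c y))
    (measurable_seqNegLog_gridValues v c) ?_
  filter_upwards [hs] with ω' h y hy
  exact tendsto_seqNegLog (((continuous_driftPath v c).tendsto _).comp hy) h

lemma gridPoint_zero (n : ℕ) : gridPoint n 0 = 0 := by
  rw [gridPoint, Nat.cast_zero, zero_div]
  exact Set.projIcc_left (zero_le_one (α := ℝ))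

lemma monotone_gridPoint (n : ℕ) : Monotone (gridPoint n) := by
  intro i j hij
  refine Set.monotone_projIcc _ ?_
  gcongr

/-- The sign of the drift does not affect the law of the limit. -/
lemma IsBrownian.map_minObjective_neg (hB : IsBrownian B P') (hw : IsWeight w) (c : E d) :
    P'.map (fun ω' => -minObjective (drifted w S (-c) (B ω'))) =
      P'.map (fun ω' => -minObjective (drifted w S c (B ω'))) := by
  set v := weightPath w hw.continuousOn with hv
  set c' := Matrix.toEuclideanCLM (𝕜 := ℝ) (matrixSqrt S)⁻¹ c with hc'
  -- The limits for `B` and `-B` are compared through their grid approximations: for fixed `n` these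
  -- have equal laws, as they involve only grid values, and limits in distribution are unique.
  have h1 : TendstoInDistribution
      (fun n ω => seqNegLog n (gridValues n (driftPath v c' (B ω)))) atTop
      (fun ω' => -minObjective (drifted w S c (B ω'))) (fun _ => P') P' :=
    tendstoInDistribution_seqNegLog (tendstoInDistribution_const hB.measurable.aemeasurable) v c'
      (hB.ae_spans_drifted hw S c)
  have hneg : ∀ b : Paths d, minObjective (driftPath v c' (-b)) =
      minObjective (drifted w S (-c) b) := fun b => by
    rw [drifted_neg w (hw := hw.continuousOn)]
    exact minObjective_eq_of_inner_eq neg_surjective (inner_driftPath_neg v c' b)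
  have hmn : Measurable fun ω' => -B ω' := by
    have h : Continuous fun b : Paths d => -b := continuous_neg
    exact h.measurable.comp hB.measurable
  have h2 : TendstoInDistribution
      (fun n ω => seqNegLog n (gridValues n (driftPath v c' (-B ω)))) atTop
      (fun ω' => -minObjective (drifted w S (-c) (B ω'))) (fun _ => P') P' := by
    have h := tendstoInDistribution_seqNegLog (Y₀ := fun ω' => -B ω')
      (tendstoInDistribution_const hmn.aemeasurable) v c' (by
        filter_upwards [hB.ae_spans_drifted hw S (-c)] with ω' h
        rw [drifted_neg w (hw := hw.continuousOn)] at h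
        exact h.of_inner_eq (fun a ha => neg_ne_zero.mpr ha) (inner_driftPath_neg v c' _))
    simpa only [hneg] using h
  have hlaw : ∀ n, P'.map (fun ω => seqNegLog n (gridValues n (driftPath v c' (-B ω)))) =
      P'.map (fun ω => seqNegLog n (gridValues n (driftPath v c' (B ω)))) := by
    intro n
    set G : (ℕ → E d) → EReal := fun x => seqNegLog n fun i =>
      v (gridPoint n i) • (x i + (gridPoint n i : ℝ) • c') with hG
    have hGm : Measurable G :=
      (measurable_seqNegLog n).comp (measurable_pi_lambda _ fun i => by fun_prop)
    have he : ∀ t : I, Measurable fun ω' => B ω' t := fun t => by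
      have h : Continuous fun b : Paths d => b t := by fun_prop
      exact h.measurable.comp hB.measurable
    have e1 : P'.map (fun ω => seqNegLog n (gridValues n (driftPath v c' (-B ω)))) =
        (P'.map fun ω k => -B ω (gridPoint n k)).map G :=
      (Measure.map_map hGm (measurable_pi_lambda _ fun k => (he _).neg)).symm
    have e2 : P'.map (fun ω => seqNegLog n (gridValues n (driftPath v c' (B ω)))) =
        (P'.map fun ω k => B ω (gridPoint n k)).map G :=
      (Measure.map_map hGm (measurable_pi_lambda _ fun k => he _)).symm
    rw [e1, e2, hB.map_neg_grid (monotone_gridPoint n) (gridPoint_zero n)]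
  exact tendstoInDistribution_unique _ h2
    (tendstoInDistribution_congr_law h1 (Eventually.of_forall hlaw) h2.forall_aemeasurable
      h1.aemeasurable_limit rfl)

lemma measurable_negLogRatio {Ω : Type*} [MeasurableSpace Ω] {X : ℤ → Ω → E d}
    (hX : ∀ t, Measurable (X t)) (w : ℝ → ℝ) (n : ℕ) (μ : E d) :
    Measurable fun ω => negLogRatio w (fun t => X t ω) n μ := by
  refine (measurable_seqNegLog n).comp (measurable_pi_lambda _ fun i => ?_)
  have h : Measurable fun ω => ∑ j ∈ Finset.Icc 1 i, (X j ω - μ) :=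
    Finset.measurable_sum _ fun j _ => (hX j).sub_const μ
  exact h.const_smul (w ((i : ℝ) / n))

/-- Convergence of the log likelihood ratio along local alternatives, with the drift of the limit
pointing in the opposite direction. -/
lemma tendstoInDistribution_negLogRatio {Ω : Type*} [MeasurableSpace Ω] {P : Measure Ω}
    [IsProbabilityMeasure P] {X : ℤ → Ω → E d} (hX : ∀ t, Measurable (X t)) {μ₀ : E d}
    (hw : IsWeight w) (hS : S.PosDef) (hB : IsBrownian B P')
    (hFCLT : TendstoInDistribution
      (fun (n : ℕ) ω => (n : ℝ) ^ (-(1 / 2) : ℝ) • partialSumPath (fun t => X t ω) μ₀ n)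
      atTop (fun ω' => matrixPath (matrixSqrt S) (B ω')) (fun _ => P) P') (c : E d) :
    TendstoInDistribution
      (fun (n : ℕ) ω => negLogRatio w (fun t => X t ω) n (μ₀ + (n : ℝ) ^ (-(1 / 2) : ℝ) • c))
      atTop (fun ω' => -minObjective (drifted w S (-c) (B ω'))) (fun _ => P) P' := by
  have h := tendstoInDistribution_seqNegLog hFCLT (weightPath w hw.continuousOn) (-c) (by
    filter_upwards [hB.ae_spans_drifted hw S (-c)] with ω' h
    exact spans_driftPath_matrixPath hw.continuousOn hS h)
  simp only [minObjective_driftPath_matrixPath hw.continuousOn hS] at h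
  refine tendstoInDistribution_congr_law h ?_
    (fun n => (measurable_negLogRatio hX w n _).aemeasurable) h.aemeasurable_limit rfl
  filter_upwards [eventually_ge_atTop 1] with n hn
  simp only [negLogRatio_eq_gridValues hw.continuousOn _ _ _ hn]

end Limit

/-! ### Size of the likely region -/

/-- Weak duality on the logarithmic scale; zero likelihood gives `⊤`, so no boundedness of the
constraint set is needed. -/
lemma le_seqNegLog {d n : ℕ} (hn : 1 ≤ n) {T : ℕ → E d} {a : E d}
    (ha : ∀ i ∈ Finset.Icc 1 n, 0 < 1 + inner ℝ a (T i)) :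
    (((n : ℝ)⁻¹ * ∑ i ∈ Finset.Icc 1 n, Real.log (1 + inner ℝ a (T i)) : ℝ) : EReal) ≤
      seqNegLog n T := by
  have hn0 : (0 : ℝ) < n := by exact_mod_cast hn
  set Q := ∏ i ∈ Finset.Icc 1 n, (1 + inner ℝ a (T i)) with hQ
  have hQ0 : 0 < Q := Finset.prod_pos ha
  have hle := seqLikelihood_mul_prod_le_one (n := n) fun i hi => (ha i hi).le
  rcases (mul_nonneg (pow_nonneg hn0.le n) (seqLikelihood_nonneg n T)).eq_or_lt with h0 | h0
  · rw [seqNegLog, ← h0, ENNReal.ofReal_zero, ENNReal.log_zero,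
      EReal.coe_mul_bot_of_pos (inv_pos.mpr hn0), EReal.neg_bot]
    exact le_top
  · rw [seqNegLog, ENNReal.log_ofReal_of_pos h0, ← EReal.coe_mul, ← EReal.coe_neg,
      EReal.coe_le_coe_iff, ← mul_neg]
    refine mul_le_mul_of_nonneg_left ?_ (inv_pos.mpr hn0).le
    rw [← Real.log_prod fun i hi => (ha i hi).ne', le_neg, ← Real.log_inv]
    refine Real.log_le_log h0 ?_
    rwa [← one_div, le_div_iff₀ hQ0]

lemma negLogRatio_anti {d : ℕ} {w : ℝ → ℝ} {x : ℤ → E d} {n : ℕ} {μ μ' : E d}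
    (h : ratio w x n μ ≤ ratio w x n μ') : negLogRatio w x n μ' ≤ negLogRatio w x n μ := by
  refine EReal.neg_le_neg_iff.mpr (mul_le_mul_of_nonneg_left ?_ ?_)
  · exact ENNReal.log_monotone (ENNReal.ofReal_le_ofReal h)
  · exact EReal.coe_nonneg.mpr (by positivity)

/-- The path `t ↦ log (1/2 + |s| |t v(t)|)`. -/
noncomputable def logGrowthPath (v : C(I, ℝ)) (s : ℝ) : C(I, ℝ) where
  toFun t := Real.log (1 / 2 + |s| * |(t : ℝ) * v t|)
  continuous_toFun := by
    refine Continuous.log (by fun_prop) fun t => ?_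
    positivity

/-- On `[δ/4, δ/2]` the function `t w(t)` is bounded below by some `κ > 0`, so the integrand there
grows without bound in `s`; elsewhere it is at least `-log 2`. -/
lemma exists_lt_integral_logGrowthPath {w : ℝ → ℝ} (hw : IsWeight w) (K : ℝ) :
    ∃ s, 0 ≤ s ∧ K < ∫ t, logGrowthPath (weightPath w hw.continuousOn) s t := by
  obtain ⟨δ, hδ, hpos⟩ := hw.pos
  have hδ0 := hδ.1
  have hδ1 := hδ.2
  set v := weightPath w hw.continuousOn with hv
  set t₁ : I := ⟨δ / 4, by positivity, by linarith⟩ with ht₁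
  set t₂ : I := ⟨δ / 2, by positivity, by linarith⟩ with ht₂
  have hcont : Continuous fun t : I => |(t : ℝ) * v t| := by fun_prop
  obtain ⟨t₀, ht₀, hmin⟩ := (isCompact_Icc (a := t₁) (b := t₂)).exists_isMinOn
    ⟨t₁, Set.left_mem_Icc.mpr (Subtype.coe_le_coe.mp (by simp [ht₁, ht₂]; linarith))⟩
    hcont.continuousOn
  set κ := |(t₀ : ℝ) * v t₀| with hκ
  have hκ0 : 0 < κ := by
    have h1 : δ / 4 ≤ (t₀ : ℝ) := Subtype.coe_le_coe.mpr ht₀.1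
    have h2 : (t₀ : ℝ) ≤ δ / 2 := Subtype.coe_le_coe.mpr ht₀.2
    have h3 : 0 < v t₀ := hpos t₀ ⟨by linarith, by linarith⟩
    have h4 : (0 : ℝ) < t₀ := by linarith
    positivity
  -- Chosen so that the interval of length `δ / 4` contributes at least `K + log 2 + 1`.
  set s := Real.exp ((K + Real.log 2 + 1) / (δ / 4)) / (2 * κ) with hs
  have hs0 : 0 < s := by positivity
  refine ⟨s, hs0.le, ?_⟩
  have hval : (K + Real.log 2 + 1) / (δ / 4) ≤ Real.log (1 + 2 * s * κ) := by
    rw [Real.le_log_iff_exp_le (by positivity)]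
    have : 2 * s * κ = Real.exp ((K + Real.log 2 + 1) / (δ / 4)) := by
      rw [hs]; field_simp
    linarith
  have hvol : (volume : Measure I).real (Set.Icc t₁ t₂) = δ / 4 := by
    rw [Measure.real, unitInterval.volume_Icc, ENNReal.toReal_ofReal]
    · change δ / 2 - δ / 4 = δ / 4
      ring
    · change 0 ≤ δ / 2 - δ / 4
      linarith
  have hpt : ∀ t, -Real.log 2 +
      (Set.Icc t₁ t₂).indicator (fun _ => Real.log (1 + 2 * s * κ)) t ≤ logGrowthPath v s t := by
    intro t
    change _ ≤ Real.log (1 / 2 + |s| * |(t : ℝ) * v t|)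
    rw [abs_of_pos hs0, ← Real.log_inv]
    by_cases ht : t ∈ Set.Icc t₁ t₂
    · rw [Set.indicator_of_mem ht, ← Real.log_mul (by norm_num) (by positivity)]
      refine Real.log_le_log (by positivity) ?_
      have h1 : κ ≤ |(t : ℝ) * v t| := hmin ht
      have h2 := mul_le_mul_of_nonneg_left h1 hs0.le
      linarith
    · rw [Set.indicator_of_notMem ht, add_zero]
      refine Real.log_le_log (by norm_num) ?_
      have : 0 ≤ s * |(t : ℝ) * v t| := by positivity
      linarith
  have hi1 : Integrable ((Set.Icc t₁ t₂).indicator fun _ : I => Real.log (1 + 2 * s * κ)) :=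
    (integrable_const _).indicator measurableSet_Icc
  have hint := integral_mono ((integrable_const (-Real.log 2)).add hi1)
    (integrable_path (logGrowthPath v s)) hpt
  rw [integral_add' (integrable_const _) hi1, integral_indicator_const _ measurableSet_Icc,
    hvol] at hint
  simp only [integral_const, probReal_univ, smul_eq_mul] at hint
  rw [div_le_iff₀ (by positivity)] at hval
  linarith

/-- If the path is bounded by `A` and the log likelihood ratio at drift `-c` is at most `K`, then
`c` is bounded. -/
lemma norm_le_of_seqNegLog_le {d n : ℕ} (hn : 1 ≤ n) {v : C(I, ℝ)} (hv : ∀ t, 0 ≤ v t)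
    {y : Paths d} {A s K : ℝ} (hA : ‖y‖ ≤ A) (hs : 0 ≤ s)
    (hK : K < gridAvg n (logGrowthPath v s)) {c : E d}
    (hc : seqNegLog n (gridValues n (driftPath v (-c) y)) ≤ K) :
    ‖c‖ ≤ 2 * (‖v‖ * A + 1) * s := by
  by_contra! hcon
  have hA0 : 0 ≤ A := (norm_nonneg y).trans hA
  -- With `‖a‖ = 1 / D` the path contributes at most `1 / 2` in absolute value, while the drift
  -- contributes `t v(t) ‖c‖ / D ≥ s t v(t)`.
  set D := 2 * (‖v‖ * A + 1) with hD
  have hD0 : 0 < D := by positivity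
  have hc0 : 0 < ‖c‖ := lt_of_le_of_lt (by positivity) hcon
  set a : E d := -(D⁻¹ * ‖c‖⁻¹) • c with ha
  have hna : ‖a‖ = D⁻¹ := by
    rw [ha, norm_smul, norm_neg, norm_mul, norm_inv, norm_inv, norm_norm,
      Real.norm_of_nonneg hD0.le, mul_assoc, inv_mul_cancel₀ hc0.ne', mul_one]
  have hac : inner ℝ a (-c) = D⁻¹ * ‖c‖ := by
    rw [ha, inner_smul_left, inner_neg_right, real_inner_self_eq_norm_sq]
    simp only [conj_trivial]
    field_simp
  have hlow : ∀ t : I, 1 / 2 + |s| * |(t : ℝ) * v t| ≤ 1 + inner ℝ a (driftPath v (-c) y t) := by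
    intro t
    have e1 : inner ℝ a (driftPath v (-c) y t) =
        v t * inner ℝ a (y t) + D⁻¹ * ‖c‖ * ((t : ℝ) * v t) := by
      change inner ℝ a (v t • (y t + (t : ℝ) • (-c))) = _
      rw [inner_smul_right, inner_add_right, inner_smul_right, hac]
      ring
    have e2 : |v t * inner ℝ a (y t)| ≤ 1 / 2 := by
      calc |v t * inner ℝ a (y t)| ≤ ‖v‖ * (D⁻¹ * A) := by
            rw [abs_mul]
            refine mul_le_mul (v.norm_coe_le_norm t) ((abs_real_inner_le_norm _ _).trans ?_)
              (abs_nonneg _) (norm_nonneg _)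
            rw [hna]
            exact mul_le_mul_of_nonneg_left ((y.norm_coe_le_norm t).trans hA) (by positivity)
        _ = (‖v‖ * A) / D := by ring
        _ ≤ 1 / 2 := by
            rw [div_le_iff₀ hD0, hD]
            linarith
    have htv : 0 ≤ (t : ℝ) * v t := mul_nonneg t.2.1 (hv t)
    have e3 : s ≤ D⁻¹ * ‖c‖ := by
      rw [← div_eq_inv_mul, le_div_iff₀ hD0]
      linarith
    have e4 := mul_le_mul_of_nonneg_right e3 htv
    rw [abs_of_nonneg hs, abs_of_nonneg htv, e1]
    linarith [(abs_le.mp e2).1]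
  have hpos : ∀ t : I, 0 < 1 / 2 + |s| * |(t : ℝ) * v t| := fun t => by positivity
  have h1 := (le_seqNegLog (T := gridValues n (driftPath v (-c) y)) (a := a) hn
    fun i _ => (hpos _).trans_le (hlow (gridPoint n i))).trans hc
  rw [EReal.coe_le_coe_iff] at h1
  have h2 : gridAvg n (logGrowthPath v s) ≤ (n : ℝ)⁻¹ * ∑ i ∈ Finset.Icc 1 n,
      Real.log (1 + inner ℝ a (gridValues n (driftPath v (-c) y) i)) := by
    refine mul_le_mul_of_nonneg_left (Finset.sum_le_sum fun i _ => ?_) (by positivity)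
    exact Real.log_le_log (hpos _) (hlow (gridPoint n i))
  linarith

/-- Deterministic core of the rate: any `μ` in the likely region is `μ₀ + n ^ (-1/2) c` with log
likelihood ratio no worse than at `μ₀`, so `c` is bounded. -/
lemma likelyRadius_le {d n : ℕ} (hn : 1 ≤ n) {w : ℝ → ℝ} (hw : IsWeight w) {x : ℤ → E d}
    {μ₀ : E d} {A s K : ℝ}
    (hA : ‖(n : ℝ) ^ (-(1 / 2) : ℝ) • partialSumPath x μ₀ n‖ ≤ A) (hs : 0 ≤ s)
    (hK : K < gridAvg n (logGrowthPath (weightPath w hw.continuousOn) s))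
    (h0 : negLogRatio w x n μ₀ ≤ K) :
    likelyRadius w x n μ₀ ≤ ENNReal.ofReal
      (2 * (‖weightPath w hw.continuousOn‖ * A + 1) * s * (n : ℝ) ^ (-(1 / 2) : ℝ)) := by
  have hn0 : (0 : ℝ) < n := by exact_mod_cast hn
  refine iSup₂_le fun μ hμ => ?_
  set r : ℝ := (n : ℝ) ^ (-(1 / 2) : ℝ) with hr
  have hr0 : 0 < r := Real.rpow_pos_of_pos hn0 _
  set c : E d := r⁻¹ • (μ - μ₀) with hc
  have hrc : r • c = μ - μ₀ := by rw [hc, smul_inv_smul₀ hr0.ne']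
  have hμc : μ = μ₀ + r • c := by rw [hrc]; abel
  have h1 := (negLogRatio_anti hμ.1).trans h0
  rw [hμc, negLogRatio_eq_gridValues hw.continuousOn _ _ _ hn] at h1
  have h2 := norm_le_of_seqNegLog_le hn (fun t => hw.nonneg t t.2) hA hs hK h1
  rw [← hrc, ← ofReal_norm, norm_smul, Real.norm_of_nonneg hr0.le, mul_comm]
  exact ENNReal.ofReal_le_ofReal (mul_le_mul_of_nonneg_right h2 hr0.le)

/-- The maximum radius of the likely region is of order `n ^ (-1/2)` in probability. -/
lemma isBigOInProbability_likelyRadius {Ω Ω' : Type*} [MeasurableSpace Ω] [MeasurableSpace Ω']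
    {P : Measure Ω} [IsProbabilityMeasure P] {P' : Measure Ω'} [IsProbabilityMeasure P'] {d : ℕ}
    {w : ℝ → ℝ} (hw : IsWeight w) {X : ℤ → Ω → E d} {μ₀ : E d} {Y₀ : Ω' → Paths d}
    (hFCLT : TendstoInDistribution
      (fun (n : ℕ) ω => (n : ℝ) ^ (-(1 / 2) : ℝ) • partialSumPath (fun t => X t ω) μ₀ n)
      atTop Y₀ (fun _ => P) P') {Z : Ω' → EReal}
    (hZ : TendstoInDistribution (fun (n : ℕ) ω => negLogRatio w (fun t => X t ω) n μ₀) atTop Z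
      (fun _ => P) P') (hfin : ∀ᵐ ω' ∂P', Z ω' < ⊤) :
    IsBigOInProbability P (fun n ω => likelyRadius w (fun t => X t ω) n μ₀)
      (fun n => (n : ℝ) ^ (-(1 / 2) : ℝ)) := by
  intro ε hε
  have hε2 : 0 < ENNReal.ofReal (ε / 2) := ENNReal.ofReal_pos.mpr (by positivity)
  obtain ⟨k₁, hk₁⟩ := exists_eventually_measure_le hFCLT (F := fun k : ℕ => {y | (k : ℝ) ≤ ‖y‖})
    (fun k => isClosed_le continuous_const continuous_norm)
    (fun k l hkl y (hy : (l : ℝ) ≤ ‖y‖) => (Nat.cast_le.mpr hkl).trans hy)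
    (Eventually.of_forall fun ω' => by
      obtain ⟨k, hk⟩ := exists_nat_gt ‖Y₀ ω'‖
      exact ⟨k, not_le.mpr hk⟩) hε2
  obtain ⟨k₂, hk₂⟩ := exists_eventually_measure_le hZ
    (F := fun k : ℕ => Set.Ici ((k : ℝ) : EReal)) (fun k => isClosed_Ici)
    (fun k l hkl => Set.Ici_subset_Ici.mpr (EReal.coe_le_coe_iff.mpr (Nat.cast_le.mpr hkl)))
    (by
      filter_upwards [hfin] with ω' h
      obtain ⟨x, hx, -⟩ := EReal.lt_iff_exists_real_btwn.mp h
      obtain ⟨k, hk⟩ := exists_nat_gt x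
      exact ⟨k, not_le.mpr (hx.trans (EReal.coe_lt_coe_iff.mpr hk))⟩) hε2
  -- `k₁` bounds the path and `k₂` the value at `μ₀`, each failing with probability at most `ε / 2`;
  -- `s` depends only on `k₂`.
  obtain ⟨s, hs, hsK⟩ := exists_lt_integral_logGrowthPath hw k₂
  refine ⟨2 * (‖weightPath w hw.continuousOn‖ * k₁ + 1) * s, ?_⟩
  filter_upwards [hk₁, hk₂, eventually_ge_atTop 1,
    (tendsto_gridAvg (logGrowthPath (weightPath w hw.continuousOn) s)).eventually
      (lt_mem_nhds hsK)] with n h1 h2 hn h3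
  calc P {ω | _} ≤ P ({ω | (n : ℝ) ^ (-(1 / 2) : ℝ) • partialSumPath (fun t => X t ω) μ₀ n ∈
          {y : Paths d | (k₁ : ℝ) ≤ ‖y‖}} ∪
        {ω | negLogRatio w (fun t => X t ω) n μ₀ ∈ Set.Ici ((k₂ : ℝ) : EReal)}) := by
        refine measure_mono fun ω hω => ?_
        by_contra hcon
        rw [Set.mem_union, not_or] at hcon
        have e1 : ‖(n : ℝ) ^ (-(1 / 2) : ℝ) • partialSumPath (fun t => X t ω) μ₀ n‖ < k₁ :=
          not_le.mp hcon.1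
        have e2 : negLogRatio w (fun t => X t ω) n μ₀ < ((k₂ : ℝ) : EReal) := not_le.mp hcon.2
        exact absurd (likelyRadius_le hn hw e1.le hs h3 e2.le) (not_le.mpr hω)
    _ ≤ ENNReal.ofReal (ε / 2) + ENNReal.ofReal (ε / 2) :=
        (measure_union_le _ _).trans (add_le_add h1 h2)
    _ = ENNReal.ofReal ε := by
        rw [← ENNReal.ofReal_add (by positivity) (by positivity), add_halves]

end EBEL

theorem corollary1 {Ω Ω' : Type*} [MeasurableSpace Ω] [MeasurableSpace Ω']
    (P : Measure Ω) [IsProbabilityMeasure P] (P' : Measure Ω') [IsProbabilityMeasure P']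
    (d : ℕ) (w : ℝ → ℝ) (hw : EBEL.IsWeight w)
    (X : ℤ → Ω → EBEL.E d) (hX : EBEL.IsStrictlyStationary X P) (hX2 : MemLp (X 0) 2 P)
    (μ₀ : EBEL.E d) (hμ₀ : ∫ ω, X 0 ω ∂P = μ₀)
    (S : Matrix (Fin d) (Fin d) ℝ) (hS : EBEL.IsLongRunCovariance X P S) (hSpos : S.PosDef)
    (B : Ω' → EBEL.Paths d) (hB : EBEL.IsBrownian B P')
    (hFCLT : TendstoInDistribution
      (fun (n : ℕ) ω =>
        (n : ℝ) ^ (-(1 / 2) : ℝ) • EBEL.partialSumPath (fun t => X t ω) μ₀ n)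
      atTop (fun ω' => EBEL.matrixPath (EBEL.matrixSqrt S) (B ω')) (fun _ => P) P') :
    (∀ c : EBEL.E d,
      (∀ᵐ ω' ∂P', ∃ m : ℝ, IsLeast (EBEL.objective (EBEL.drifted w S c (B ω')) ''
        EBEL.constraintSet (EBEL.drifted w S c (B ω'))) (m : EReal)) ∧
      TendstoInDistribution
        (fun (n : ℕ) ω => EBEL.negLogRatio w (fun t => X t ω) n
          (μ₀ + (n : ℝ) ^ (-(1 / 2) : ℝ) • c))
        atTop (fun ω' => -EBEL.minObjective (EBEL.drifted w S c (B ω'))) (fun _ => P) P' ∧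
      TendstoInDistribution
        (fun (n : ℕ) ω => EBEL.negLogRatio w (fun t => X t ω) n
          (μ₀ - (n : ℝ) ^ (-(1 / 2) : ℝ) • c))
        atTop (fun ω' => -EBEL.minObjective (EBEL.drifted w S c (B ω'))) (fun _ => P) P') ∧
    EBEL.IsBigOInProbability P
      (fun n ω => EBEL.likelyRadius w (fun t => X t ω) n μ₀)
      (fun n => (n : ℝ) ^ (-(1 / 2) : ℝ)) := by
  have hmain := fun c => EBEL.tendstoInDistribution_negLogRatio hX.measurable hw hSpos hB hFCLT
    (c := c)
  have hleast : ∀ c : EBEL.E d, ∀ᵐ ω' ∂P', ∃ m : ℝ,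
      IsLeast (EBEL.objective (EBEL.drifted w S c (B ω')) ''
        EBEL.constraintSet (EBEL.drifted w S c (B ω'))) (m : EReal) := by
    intro c
    filter_upwards [hB.ae_spans_drifted hw S c] with ω' h
    rw [EBEL.drifted_eq_driftPath hw.continuousOn] at h ⊢
    exact EBEL.isLeast_objective h
  have hminus : ∀ c : EBEL.E d, TendstoInDistribution
        (fun (n : ℕ) ω => EBEL.negLogRatio w (fun t => X t ω) n
          (μ₀ - (n : ℝ) ^ (-(1 / 2) : ℝ) • c))
        atTop (fun ω' => -EBEL.minObjective (EBEL.drifted w S c (B ω'))) (fun _ => P) P' := by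
    -- Centering at `μ₀ - n ^ (-1/2) c` gives drift `+c` directly; the other sign needs the symmetry
    -- of the limit law.
    intro c
    have h := hmain (-c)
    simpa only [smul_neg, ← sub_eq_add_neg, neg_neg] using h
  refine ⟨fun c => ⟨hleast c, ?_, hminus c⟩, ?_⟩
  · exact EBEL.tendstoInDistribution_congr_law (hmain c) (Eventually.of_forall fun n => rfl)
      (hmain c).forall_aemeasurable (hminus c).aemeasurable_limit (hB.map_minObjective_neg hw c)
  -- The case `c = 0` has an almost surely finite limit, which is the tightness required at `μ₀`.
  · have h0 := hminus 0
    simp only [smul_zero, sub_zero] at h0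
    refine EBEL.isBigOInProbability_likelyRadius hw hFCLT h0 ?_
    filter_upwards [hleast 0] with ω' ⟨m, hm⟩
    have hmin : EBEL.minObjective (EBEL.drifted w S 0 (B ω')) = (m : EReal) := hm.csInf_eq
    rw [hmin, ← EReal.coe_neg]
    exact EReal.coe_lt_top _
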